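/- Let $G$ be a finite simple graph with at least three vertices that is 2-connected (that is, $G$ and $G-v$ for every vertex $v$ are connected) and outerplanar, and fix a planar embedding of $G$ whose outer face is incident to all vertices. Let $G^*$ be its weak dual: the vertices of $G^*$ are the faces other than the outer one, and two faces are adjacent when they share an edge; $G^*$ is a tree. A vertex of $G^*$ is a *leaf* if its degree is one (the vertex of a one-vertex tree, which arises when $G$ is a cycle, also counts as a leaf). *Branch vertices* are defined recursively: a vertex of degree two is a branch vertex if it is adjacent to a leaf or to another branch vertex (so that it is joined to a leaf by a path of degree-two vertices). A *trunk vertex* is a vertex of degree at least two that is adjacent to neither a leaf nor a branch vertex. $G$ has *no trunk cycles* if $G^*$ has no trunk vertex. The *leaf cycles* of $G$ are the faces that are leaves of $G^*$, and $n_\ell$ is their number. A set of initially blue vertices is *zero forcing* if all vertices become blue under repeated application of the rule that a blue vertex with exactly one white neighbor turns that neighbor blue; $Z(G)$ is the minimum size of a zero forcing set. If $G$ has no trunk cycles, then $$Z(G)\le 2\left\lceil \frac{n_\ell}{2}\right\rceil .$$ Moreover, some zero forcing set of $G$ is obtained by coloring two adjacent vertices on every other leaf cycle: there are $\lceil n_\ell/2\rceil$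 leaf cycles, including at least one of any two distinct leaf cycles that are consecutive along the outer face, and a choice of two adjacent vertices on each of them, such that all the chosen vertices together form a zero forcing set. -/

import Mathlib

universe u

/-! ### Zero forcing -/

/-- `Blue G B v`: the vertex `v` is eventually blue when the vertices of `B` are initially blue and
the color changing rule (a blue vertex `u` with exactly one white neighbor `v` turns `v` blue)
is applied as long as possible. -/
inductive Blue {V : Type u} (G : SimpleGraph V) (B : Set V) : V → Prop
  | init {v : V} (hv : v ∈ B) : Blue G B v
  | force {u v : V} (hu : Blue G B u) (huv : G.Adj u v)
      (hw : ∀ w : V, G.Adj u w → w ≠ v → Blue G B w) : Blue G B v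

/-- `B` is a zero forcing set of `G`: it forces the entire graph to be blue. -/
def IsZeroForcingSet {V : Type u} (G : SimpleGraph V) (B : Set V) : Prop :=
  ∀ v : V, Blue G B v

/-- The zero forcing number `Z(G)` of a finite graph: the minimum size of a zero forcing set. -/
noncomputable def zeroForcingNumber {V : Type u} (G : SimpleGraph V) : ℕ :=
  sInf {k : ℕ | ∃ B : Set V, IsZeroForcingSet G B ∧ B.ncard = k}

/-! ### Connectivity -/

/-- `G` is `k`-connected: for every set `S` of fewer than `k` vertices, the graph induced on the
complement of `S` is connected. -/
def IsVertexConnected {V : Type u} (G : SimpleGraph V) (k : ℕ) : Prop :=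
  ∀ S : Set V, S.Finite → S.ncard < k → (G.induce Sᶜ).Connected

/-! ### Combinatorial embeddings -/

/-- A rotation system on `G`: a permutation of the darts (oriented edges) whose orbits are exactly
the sets of darts leaving a common vertex, i.e. a cyclic order of the edges around each vertex. -/
structure RotationSystem {V : Type u} (G : SimpleGraph V) where
  next : Equiv.Perm G.Dart
  sameCycle_iff : ∀ d e : G.Dart, next.SameCycle d e ↔ d.fst = e.fst

namespace RotationSystem

variable {V : Type u} {G : SimpleGraph V}

/-- Face tracing: traverse the dart `d = (u, v)`, then leave `v` along the dart that follows
`(v, u)` in the rotation at `v`. -/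
def facePerm (R : RotationSystem G) : Equiv.Perm G.Dart :=
  (SimpleGraph.Dart.symm_involutive (G := G)).toPerm.trans R.next

/-- The faces of the embedding are the orbits of face tracing. -/
def Face (R : RotationSystem G) : Type u :=
  Quotient (Equiv.Perm.SameCycle.setoid R.facePerm)

/-- The face on whose boundary walk the dart `d` lies. The two faces bordering the edge of `d` are
`R.face d` and `R.face d.symm`. -/
def face (R : RotationSystem G) (d : G.Dart) : R.Face :=
  Quotient.mk (Equiv.Perm.SameCycle.setoid R.facePerm) d

/-- The vertex `v` is incident to the face `f`. -/
def Incident (R : RotationSystem G) (v : V) (f : R.Face) : Prop :=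
  ∃ d : G.Dart, R.face d = f ∧ d.fst = v

/-- Euler's formula `|V| - |E| + |F| = 2`: for a finite connected graph with at least one edge, it
says that the rotation system is that of an embedding in the sphere (equivalently, after the
choice of an outer face, in the plane). -/
def IsPlanar (R : RotationSystem G) : Prop :=
  Nat.card V + Nat.card R.Face = Nat.card G.edgeSet + 2

end RotationSystem

/-- An outerplanar embedding of a finite connected graph with at least one edge: a planar embedding
with a chosen outer face that is incident to all vertices. -/
structure OuterplanarEmbedding {V : Type u} (G : SimpleGraph V) extends RotationSystem G where
  planar : toRotationSystem.IsPlanar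
  outer : toRotationSystem.Face
  incident_outer : ∀ v : V, toRotationSystem.Incident v outer

/-! ### Leaves, branches and trunk of a tree -/

section Tree

variable {W : Type u} (T : SimpleGraph W)

/-- The degree of a vertex (meaningful for finite graphs). -/
noncomputable def deg (x : W) : ℕ := (T.neighborSet x).ncard

/-- A leaf: a vertex of degree one. The only vertex of the one-vertex tree (the weak dual of a cycle)
is a leaf as well. -/
def IsLeafVertex (x : W) : Prop := deg T x ≤ 1

/-- A branch vertex: a vertex of degree two that is adjacent to a leaf or to another branch
vertex. -/
inductive IsBranchVertex : W → Prop
  | of_leaf {x y : W} (hx : deg T x = 2) (hxy : T.Adj x y) (hy : IsLeafVertex T y) :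
      IsBranchVertex x
  | of_branch {x y : W} (hx : deg T x = 2) (hxy : T.Adj x y) (hy : IsBranchVertex y) :
      IsBranchVertex x

/-- A trunk vertex: a vertex of degree at least two that is adjacent to neither a leaf nor a
branch vertex. -/
def IsTrunkVertex (x : W) : Prop :=
  2 ≤ deg T x ∧ ∀ y : W, T.Adj x y → ¬ IsLeafVertex T y ∧ ¬ IsBranchVertex T y

end Tree

/-! ### The weak dual and the leaf cycles -/

namespace OuterplanarEmbedding

variable {V : Type u} {G : SimpleGraph V}

/-- The faces other than the outer face. -/
def InnerFace (E : OuterplanarEmbedding G) : Type u :=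
  {f : E.toRotationSystem.Face // f ≠ E.outer}

/-- The weak dual: two distinct inner faces are adjacent when they share an edge. -/
def weakDual (E : OuterplanarEmbedding G) : SimpleGraph E.InnerFace where
  Adj f g := f ≠ g ∧ ∃ d : G.Dart,
    E.toRotationSystem.face d = f.1 ∧ E.toRotationSystem.face d.symm = g.1
  symm := ⟨by
    rintro f g ⟨hne, d, hd, hd'⟩
    exact ⟨hne.symm, d.symm, hd', by rw [SimpleGraph.Dart.symm_symm]; exact hd⟩⟩
  loopless := ⟨fun _ h => h.1 rfl⟩

/-- The set of leaf faces (their boundaries are the leaf cycles). -/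
def leafFaces (E : OuterplanarEmbedding G) : Set E.InnerFace :=
  {f | IsLeafVertex E.weakDual f}

/-- The number of leaf cycles. -/
noncomputable def numLeaves (E : OuterplanarEmbedding G) : ℕ := E.leafFaces.ncard

/-- There are no trunk cycles, i.e. the weak dual has no trunk vertex. -/
def NoTrunkCycles (E : OuterplanarEmbedding G) : Prop :=
  ∀ f : E.InnerFace, ¬ IsTrunkVertex E.weakDual f

/-- `g` is the next leaf face after the leaf face `f` along the outer face: walking along the
boundary of the outer face from some edge of `f`, the first later edge that lies on a leaf face
lies on `g`. -/
def NextLeaf (E : OuterplanarEmbedding G) (f g : E.InnerFace) : Prop :=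
  f ∈ E.leafFaces ∧ g ∈ E.leafFaces ∧
    ∃ (d : G.Dart) (k : ℕ), E.toRotationSystem.face d = E.outer ∧ 0 < k ∧
      E.toRotationSystem.face d.symm = f.1 ∧
      E.toRotationSystem.face ((E.facePerm ^ k) d).symm = g.1 ∧
      ∀ j : ℕ, 0 < j → j < k → ∀ h ∈ E.leafFaces,
        E.toRotationSystem.face ((E.facePerm ^ j) d).symm ≠ h.1

/-- `S` consists of every other leaf face: it has `⌈n_ℓ / 2⌉` members, and of any two distinct leaf
faces that are consecutive along the outer face at least one belongs to `S`. -/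
def IsEveryOtherLeaf (E : OuterplanarEmbedding G) (S : Set E.InnerFace) : Prop :=
  S ⊆ E.leafFaces ∧ S.ncard = ⌈(E.numLeaves : ℚ) / 2⌉₊ ∧
    ∀ f g : E.InnerFace, f ≠ g → E.NextLeaf f g → f ∈ S ∨ g ∈ S

end OuterplanarEmbedding

/-! The embedding is a polygon dissected by noncrossing chords. Over `ZMod 2`, Euler's formula says
that every cycle is the boundary of a set of faces (`exists_faceBoundary_eq`). With 2-connectedness
this gives distinct faces on the two sides of each edge and a connected weak dual. A count in which
every inequality must be tight then shows that each vertex is the tail of exactly one outer dart,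
that chords correspond to edges of the weak dual, and that the weak dual is a tree (`isDissection`).

Root the tree at a leaf `L`, cut the outer walk at `L`, and let `κ v` be the number of other leaves
met before `v`. The label is constant along outer edges of non-leaf faces and rises by one across a
leaf. Color `L` and the leaves entered at an odd label: this is every other leaf. At each vertex the
parity of `κ` prescribes the direction in which the blue color turns around that vertex. A colored
leaf then needs no help from outside, an uncolored leaf is fed at both ends, and an outer edge off
the leaves is fed at exactly one end.

What remains is that these dependencies are not circular. On a path of boundary edges of a face each
edge waits for at most one neighbor at each inner vertex, so the parts behind the edges can be
filled in order (`good_of_path`). Circularity could only arise through the edge to the parent face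
when both its ends have the same parity. This is where the absence of trunk cycles enters: every
non-leaf face has a pendant path of the weak dual attached, across which `κ` changes by one
(`succ_of_pathOut`), and a vertex of the other parity breaks the circle (`fills_of_children`,
`IsLabeling.fills`). Starting from the colored root `L` the blue color spreads down the tree
(`forall_mem`). -/

namespace RotationSystem

variable {V : Type u} {G : SimpleGraph V} (R : RotationSystem G)

/-! ### Rotation systems and face tracing. -/

theorem next_fst (d : G.Dart) : (R.next d).fst = d.fst :=
  ((R.sameCycle_iff d (R.next d)).1 ⟨1, by simp⟩).symm

theorem facePerm_apply (d : G.Dart) : R.facePerm d = R.next d.symm := rfl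

theorem facePerm_symm_apply (d : G.Dart) : R.facePerm d.symm = R.next d := by
  rw [facePerm_apply, SimpleGraph.Dart.symm_symm]

theorem facePerm_fst (d : G.Dart) : (R.facePerm d).fst = d.snd := by
  rw [facePerm_apply, next_fst]; rfl

theorem face_eq_iff {d e : G.Dart} : R.face d = R.face e ↔ R.facePerm.SameCycle d e :=
  Quotient.eq (r := Equiv.Perm.SameCycle.setoid R.facePerm)

theorem face_facePerm (d : G.Dart) : R.face (R.facePerm d) = R.face d :=
  R.face_eq_iff.2 (Equiv.Perm.SameCycle.symm ⟨1, by simp⟩)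

theorem face_next (d : G.Dart) : R.face (R.next d) = R.face d.symm := by
  rw [← facePerm_symm_apply, face_facePerm]

theorem face_surjective : Function.Surjective R.face := Quotient.mk_surjective

instance [Finite V] : Finite G.Dart := by
  classical
  have := Fintype.ofFinite V
  infer_instance

instance [Finite V] : Finite R.Face := Finite.of_surjective _ R.face_surjective

/-- In a connected graph, reversal and rotation together act transitively on the darts. -/
theorem forall_of_connected (hG : G.Connected) (P : G.Dart → Prop)
    (hs : ∀ d, P d → P d.symm) (hn : ∀ d, P d → P (R.next d)) [Finite V]
    {d₀ : G.Dart} (h₀ : P d₀) (d : G.Dart) : P d := by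
  have hfst : ∀ d e : G.Dart, P d → d.fst = e.fst → P e := by
    intro d e hd hde
    obtain ⟨n, -, hn'⟩ := ((R.sameCycle_iff d e).2 hde).exists_pow_eq'
    rw [← hn']
    clear hn' hde
    induction n with
    | zero => simpa using hd
    | succ n ih => rw [pow_succ', Equiv.Perm.mul_apply]; exact hn _ ih
  have hv : ∀ v w : V, G.Walk v w → (∀ e : G.Dart, e.fst = v → P e) →
      ∀ e : G.Dart, e.fst = w → P e := by
    intro v w p
    induction p with
    | nil => exact fun h => h
    | cons hadj p ih =>
      intro h
      refine ih fun e he => ?_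
      exact hfst _ _ (hs _ (h ⟨(_, _), hadj⟩ rfl)) he.symm
  obtain ⟨p⟩ := hG.preconnected d₀.fst d.fst
  exact hv _ _ p (fun e he => hfst _ _ h₀ he.symm) d rfl

/-! ### Planarity as vanishing homology modulo two. -/

section Chains

theorem add_self_fun {α : Type*} (x : α → ZMod 2) : x + x = 0 :=
  funext fun _ => CharTwo.add_self_eq_zero _

variable [Fintype V] [DecidableEq V] [DecidableRel G.Adj]

/-- The edges on the boundary of a set of faces, modulo two. -/
def faceBoundary : (R.Face → ZMod 2) →ₗ[ZMod 2] (G.edgeSet → ZMod 2) where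
  toFun h e := ∑ d : G.Dart with d.edge = e.1, h (R.face d)
  map_add' h h' := by ext e; simp [Finset.sum_add_distrib]
  map_smul' c h := by ext e; simp [Finset.mul_sum]

/-- The vertices of odd degree in a set of edges, modulo two. -/
def _root_.SimpleGraph.vertexBoundary (G : SimpleGraph V) [DecidableRel G.Adj] :
    (G.edgeSet → ZMod 2) →ₗ[ZMod 2] (V → ZMod 2) where
  toFun z v := ∑ d : G.Dart with d.fst = v, z ⟨d.edge, d.edge_mem⟩
  map_add' z z' := by ext v; simp [Finset.sum_add_distrib]
  map_smul' c z := by ext v; simp [Finset.mul_sum]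

theorem faceBoundary_apply (h : R.Face → ZMod 2) (d : G.Dart) :
    R.faceBoundary h ⟨d.edge, d.edge_mem⟩ = h (R.face d) + h (R.face d.symm) := by
  change ∑ e : G.Dart with e.edge = d.edge, h (R.face e) = _
  rw [SimpleGraph.Dart.edge_fiber, Finset.sum_pair d.symm_ne.symm]

theorem _root_.SimpleGraph.vertexBoundary_apply (z : G.edgeSet → ZMod 2) (v : V) :
    G.vertexBoundary z v = ∑ d : G.Dart with d.fst = v, z ⟨d.edge, d.edge_mem⟩ := rfl

theorem vertexBoundary_faceBoundary (h : R.Face → ZMod 2) :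
    G.vertexBoundary (R.faceBoundary h) = 0 := by
  ext v
  rw [SimpleGraph.vertexBoundary_apply]
  simp only [faceBoundary_apply, Finset.sum_add_distrib, ← R.face_next]
  rw [Finset.sum_bij (t := {d : G.Dart | d.fst = v}) (g := fun d => h (R.face d))
    (f := fun d => h (R.face (R.next d))) (fun d _ => R.next d)]
  · exact CharTwo.add_self_eq_zero _
  · intro d hd; simpa [R.next_fst] using hd
  · intro d _ e _ hde; exact R.next.injective hde
  · intro d hd
    refine ⟨R.next.symm d, ?_, by simp⟩
    have := R.next_fst (R.next.symm d)
    simp only [Equiv.apply_symm_apply] at this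
    simpa [← this] using hd
  · intro d _; rfl

/-- A set of faces without boundary takes the same value on both sides of every edge, hence is
constant by connectivity. -/
theorem finrank_ker_faceBoundary [Finite R.Face] (hG : G.Connected) :
    Module.finrank (ZMod 2) (LinearMap.ker R.faceBoundary) ≤ 1 := by
  refine finrank_le_one (⟨fun _ => 1, ?_⟩ : LinearMap.ker R.faceBoundary) ?_
  · rw [LinearMap.mem_ker]
    ext ⟨e, he⟩
    induction e with
    | _ u v =>
      have := R.faceBoundary_apply (fun _ => 1) (⟨(u, v), he⟩ : G.Dart)
      rw [CharTwo.add_self_eq_zero] at this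
      exact this
  · rintro ⟨h, hh⟩
    rcases isEmpty_or_nonempty G.Dart with hD | ⟨⟨d₀⟩⟩
    · refine ⟨0, Subtype.ext (funext fun f => ?_)⟩
      obtain ⟨d, -⟩ := R.face_surjective f
      exact hD.elim d
    · refine ⟨h (R.face d₀), Subtype.ext (funext fun f => ?_)⟩
      obtain ⟨d, rfl⟩ := R.face_surjective f
      have hs : ∀ d, h (R.face d.symm) = h (R.face d) := by
        intro d
        have h1 := R.faceBoundary_apply h d
        rw [LinearMap.mem_ker.1 hh] at h1
        exact ((CharTwo.add_eq_zero).1 h1.symm).symm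
      have := R.forall_of_connected hG (fun d => h (R.face d) = h (R.face d₀))
        (fun d hd => (hs d).trans hd) (fun d hd => by rw [R.face_next, hs, hd]) rfl d
      simp [this]

theorem _root_.SimpleGraph.vertexBoundary_single (d : G.Dart) :
    G.vertexBoundary (Pi.single ⟨d.edge, d.edge_mem⟩ 1) =
      Pi.single d.fst 1 + Pi.single d.snd 1 := by
  ext v
  rw [SimpleGraph.vertexBoundary_apply]
  have : ∀ e : G.Dart, (Pi.single (⟨d.edge, d.edge_mem⟩ : G.edgeSet) (1 : ZMod 2) :
      G.edgeSet → ZMod 2) ⟨e.edge, e.edge_mem⟩ =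
      (if e = d then 1 else 0) + (if e = d.symm then 1 else 0) := by
    intro e
    by_cases h1 : e = d
    · subst h1; simp [e.symm_ne.symm]
    · by_cases h2 : e = d.symm
      · subst h2; simp [d.symm_ne]
      · rw [Pi.single_eq_of_ne]
        · simp [h1, h2]
        · intro h
          rcases (SimpleGraph.dart_edge_eq_iff e d).1 (congrArg Subtype.val h) with h | h
          · exact h1 h
          · exact h2 h
  simp only [this, Finset.sum_add_distrib, Finset.sum_ite_eq', Finset.mem_filter,
    Finset.mem_univ, true_and, Pi.add_apply, Pi.single_apply]
  congr 1
  · simp [eq_comm]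
  · simp [eq_comm]

theorem _root_.SimpleGraph.exists_chain_of_walk (A : Set (Sym2 V)) {p q : V} (w : G.Walk p q)
    (hw : ∀ e ∈ w.edges, e ∈ A) :
    ∃ z : G.edgeSet → ZMod 2, G.vertexBoundary z = Pi.single p 1 + Pi.single q 1 ∧
      ∀ e : G.edgeSet, e.1 ∉ A → z e = 0 := by
  induction w with
  | nil =>
    refine ⟨0, ?_, fun _ _ => rfl⟩
    rw [map_zero, add_self_fun]
  | @cons u v w h p ih =>
    obtain ⟨z, hz, hA⟩ := ih fun e he => hw e (by simp [he])
    refine ⟨Pi.single ⟨s(u, v), h⟩ 1 + z, ?_, fun e he => ?_⟩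
    · rw [map_add, hz]
      have := SimpleGraph.vertexBoundary_single (⟨(u, v), h⟩ : G.Dart)
      refine (congrArg (· + _) this).trans ?_
      change (Pi.single u 1 + Pi.single v 1) + (Pi.single v 1 + Pi.single w 1) = _
      rw [add_assoc, ← add_assoc (Pi.single v 1), add_self_fun, zero_add]
    · rw [Pi.add_apply, hA e he, add_zero, Pi.single_eq_of_ne]
      rintro rfl
      exact he (hw _ (by simp))

/-- A walk from `v` to `v₀` identifies the two vertices modulo boundaries, so the quotient is
spanned by one vertex. -/
theorem card_le_finrank_range_vertexBoundary (hG : G.Connected) :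
    Fintype.card V ≤ Module.finrank (ZMod 2) (LinearMap.range G.vertexBoundary) + 1 := by
  obtain ⟨v₀⟩ := hG.nonempty
  have htop : (⊤ : Submodule (ZMod 2) (V → ZMod 2)) ≤
      LinearMap.range G.vertexBoundary ⊔ Submodule.span (ZMod 2) {Pi.single v₀ 1} := by
    rw [← (Pi.basisFun (ZMod 2) V).span_eq, Submodule.span_le]
    rintro _ ⟨v, rfl⟩
    rw [Pi.basisFun_apply]
    obtain ⟨w⟩ := hG.preconnected v v₀
    obtain ⟨z, hz, -⟩ := SimpleGraph.exists_chain_of_walk Set.univ w fun _ _ => trivial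
    have : (Pi.single v 1 : V → ZMod 2) = G.vertexBoundary z + Pi.single v₀ 1 := by
      rw [hz, add_assoc, add_self_fun, add_zero]
    rw [this]
    exact Submodule.add_mem_sup ⟨z, rfl⟩ (Submodule.mem_span_singleton_self _)
  have h1 := Submodule.finrank_mono htop
  rw [finrank_top, Module.finrank_fintype_fun_eq_card] at h1
  refine h1.trans ((Submodule.finrank_add_le_finrank_add_finrank _ _).trans ?_)
  gcongr
  exact (finrank_span_le_card _).trans (by simp)

/-- In a planar embedding every cycle is the boundary of a set of faces. -/
theorem exists_faceBoundary_eq (hG : G.Connected) (hR : R.IsPlanar)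
    {z : G.edgeSet → ZMod 2} (hz : G.vertexBoundary z = 0) : ∃ h, R.faceBoundary h = z := by
  have := Fintype.ofFinite R.Face
  have hle : LinearMap.range R.faceBoundary ≤ LinearMap.ker G.vertexBoundary := by
    rintro _ ⟨h, rfl⟩
    exact R.vertexBoundary_faceBoundary h
  have h1 := R.faceBoundary.finrank_range_add_finrank_ker
  have h2 := (G.vertexBoundary).finrank_range_add_finrank_ker
  have h3 := R.finrank_ker_faceBoundary hG
  have h4 := card_le_finrank_range_vertexBoundary hG
  rw [Module.finrank_fintype_fun_eq_card] at h1 h2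
  rw [IsPlanar, Nat.card_eq_fintype_card, Nat.card_eq_fintype_card,
    Nat.card_eq_fintype_card] at hR
  -- The range has dimension at least `|F| - 1`, the kernel at most `|E| - |V| + 1`; Euler's formula
  -- makes these equal.
  have heq := Submodule.eq_of_le_of_finrank_le hle (by omega)
  have : z ∈ LinearMap.range R.faceBoundary := by rw [heq]; exact hz
  exact this

end Chains

end RotationSystem

/-! ### Cycles in 2-connected graphs. -/

section TwoConnected

variable {V : Type u} {G : SimpleGraph V}

theorem IsVertexConnected.connected (hG : IsVertexConnected G 2) : G.Connected := by
  have h := hG ∅ Set.finite_empty (by simp)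
  rw [Set.compl_empty] at h
  exact (SimpleGraph.induceUnivIso G).connected_iff.1 h

theorem IsVertexConnected.exists_walk_avoiding (hG : IsVertexConnected G 2) {v p q : V}
    (hp : p ≠ v) (hq : q ≠ v) : ∃ w : G.Walk p q, ∀ e ∈ w.edges, v ∉ e := by
  have h := hG {v} (Set.finite_singleton v) (by simp)
  obtain ⟨w⟩ := h.preconnected ⟨p, hp⟩ ⟨q, hq⟩
  let φ : G.induce {v}ᶜ →g G := ⟨Subtype.val, fun h => h⟩
  refine ⟨w.map φ, fun e he hv => ?_⟩
  rw [SimpleGraph.Walk.edges_map, List.mem_map] at he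
  obtain ⟨e', -, rfl⟩ := he
  obtain ⟨x, -, hx⟩ := Sym2.mem_map.1 hv
  exact x.2 hx

theorem IsVertexConnected.exists_dart_ne (hG : IsVertexConnected G 2) [Finite V]
    (hV : 3 ≤ Nat.card V) (d : G.Dart) : ∃ e : G.Dart, e.fst = d.fst ∧ e ≠ d := by
  classical
  have := Fintype.ofFinite V
  obtain ⟨x, hx⟩ : ∃ x, x ∉ ({d.fst, d.snd} : Finset V) := by
    by_contra! h
    have h1 := Finset.card_le_card (fun x _ => h x : (Finset.univ : Finset V) ⊆ _)
    have h2 := Finset.card_le_two (a := d.fst) (b := d.snd)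
    rw [Finset.card_univ, ← Nat.card_eq_fintype_card] at h1
    omega
  simp only [Finset.mem_insert, Finset.mem_singleton, not_or] at hx
  obtain ⟨w, hw⟩ := hG.exists_walk_avoiding (v := d.snd) d.fst_ne_snd hx.2
  cases w with
  | nil => exact absurd rfl hx.1
  | cons h p =>
    rename_i y
    refine ⟨⟨(d.fst, y), h⟩, rfl, fun heq => hw s(d.fst, y) (by simp) ?_⟩
    rw [Sym2.mem_iff]
    right
    exact (congrArg (fun e : G.Dart => e.snd) heq).symm

/-- Two edges at a vertex are closed up by a walk avoiding that vertex, so the resulting mod 2 cycle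
uses no other edge there. -/
theorem IsVertexConnected.exists_cycle [Fintype V] [DecidableEq V] [DecidableRel G.Adj]
    (hG : IsVertexConnected G 2) {d₁ d₂ : G.Dart} (hfst : d₁.fst = d₂.fst) (hne : d₁ ≠ d₂) :
    ∃ z : G.edgeSet → ZMod 2, G.vertexBoundary z = 0 ∧ ∀ d : G.Dart, d.fst = d₁.fst →
      z ⟨d.edge, d.edge_mem⟩ = if d = d₁ ∨ d = d₂ then 1 else 0 := by
  obtain ⟨w, hw⟩ := hG.exists_walk_avoiding (v := d₁.fst) (p := d₁.snd) (q := d₂.snd)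
    d₁.snd_ne_fst (hfst ▸ d₂.snd_ne_fst)
  obtain ⟨z, hz, hA⟩ := SimpleGraph.exists_chain_of_walk {e | d₁.fst ∉ e} w hw
  refine ⟨z + (Pi.single ⟨d₁.edge, d₁.edge_mem⟩ 1 + Pi.single ⟨d₂.edge, d₂.edge_mem⟩ 1), ?_, ?_⟩
  · rw [map_add, map_add, hz, SimpleGraph.vertexBoundary_single,
      SimpleGraph.vertexBoundary_single, ← hfst]
    ext x
    simp only [Pi.add_apply, Pi.zero_apply]
    generalize (Pi.single d₁.snd (1 : ZMod 2) : V → ZMod 2) x = a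
    generalize (Pi.single d₂.snd (1 : ZMod 2) : V → ZMod 2) x = b
    generalize (Pi.single d₁.fst (1 : ZMod 2) : V → ZMod 2) x = c
    revert a b c
    decide
  · intro d hd
    have key : ∀ d' : G.Dart, d'.fst = d.fst →
        (Pi.single (⟨d'.edge, d'.edge_mem⟩ : G.edgeSet) (1 : ZMod 2) : G.edgeSet → ZMod 2)
          ⟨d.edge, d.edge_mem⟩ = if d = d' then 1 else 0 := by
      intro d' hd'
      by_cases h : d = d'
      · subst h; simp
      · rw [if_neg h, Pi.single_eq_of_ne]
        intro he
        rcases (SimpleGraph.dart_edge_eq_iff d d').1 (congrArg Subtype.val he) with he | he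
        · exact h he
        · rw [he] at hd'
          exact d'.fst_ne_snd hd'
    rw [Pi.add_apply, Pi.add_apply, key _ hd.symm, key _ (hfst.symm.trans hd.symm),
      hA _ (fun h => h (hd ▸ Sym2.mem_mk_left d.fst d.snd)), zero_add]
    by_cases h1 : d = d₁
    · subst h1; simp [hne]
    · simp [h1]

end TwoConnected

/-! ### Outerplanar embeddings as dissected polygons. -/

namespace RotationSystem

variable {V : Type u} {G : SimpleGraph V} {R : RotationSystem G}

/-- An edge with the same face on both sides has coefficient zero in every face boundary, yet some
cycle uses it. -/
theorem IsPlanar.face_ne_face_symm [Finite V] (hR : R.IsPlanar) (hV : 3 ≤ Nat.card V)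
    (hG : IsVertexConnected G 2) (d : G.Dart) : R.face d ≠ R.face d.symm := by
  classical
  have := Fintype.ofFinite V
  obtain ⟨e, he, hne⟩ := hG.exists_dart_ne hV d
  obtain ⟨z, hz, hval⟩ := hG.exists_cycle he.symm hne.symm
  obtain ⟨h, rfl⟩ := R.exists_faceBoundary_eq hG.connected hR hz
  intro heq
  have := hval d rfl
  rw [faceBoundary_apply, ← heq, CharTwo.add_self_eq_zero, if_pos (Or.inl rfl)] at this
  exact zero_ne_one this

end RotationSystem

namespace OuterplanarEmbedding

variable {V : Type u} {G : SimpleGraph V} (E : OuterplanarEmbedding G)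

instance [Finite V] : Finite E.InnerFace :=
  inferInstanceAs (Finite {f : E.toRotationSystem.Face // f ≠ E.outer})

/-- If a component `A` of inner faces is not everything, some vertex has an edge bordering `A` and
one that does not. Take a cycle through exactly these two edges there. Its part bordering `A` is
again the boundary of a set of faces, but has odd degree at that vertex. -/
theorem weakDual_connected [Finite V] (hV : 3 ≤ Nat.card V) (hG : IsVertexConnected G 2) :
    E.weakDual.Connected := by
  classical
  have := Fintype.ofFinite V
  have hne := E.planar.face_ne_face_symm hV hG
  have hnonempty : Nonempty E.InnerFace := by
    obtain ⟨v⟩ := hG.connected.nonempty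
    obtain ⟨d, hd, -⟩ := E.incident_outer v
    exact ⟨⟨E.face d.symm, fun h => hne d (hd.trans h.symm)⟩⟩
  refine (SimpleGraph.connected_iff _).2 ⟨fun f₀ g₀ => ?_, hnonempty⟩
  by_contra hfg
  let A : Set E.Face := {f | ∃ h : f ≠ E.outer, E.weakDual.Reachable f₀ ⟨f, h⟩}
  have hadj : ∀ d, E.face d ∈ A → E.face d.symm ≠ E.outer → E.face d.symm ∈ A := by
    rintro d ⟨h, hr⟩ h'
    refine ⟨h', hr.trans (SimpleGraph.Adj.reachable ⟨?_, d, rfl, rfl⟩)⟩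
    exact fun heq => hne d (congrArg Subtype.val heq)
  let P : G.Dart → Prop := fun d => E.face d ∈ A ∨ E.face d.symm ∈ A
  obtain ⟨d₁, d₂, hfst, h1, h2⟩ : ∃ d₁ d₂ : G.Dart, d₁.fst = d₂.fst ∧ P d₁ ∧ ¬ P d₂ := by
    by_contra! h
    obtain ⟨a, ha⟩ := E.face_surjective f₀.1
    obtain ⟨b, hb⟩ := E.face_surjective g₀.1
    have hPa : P a := Or.inl (ha ▸ ⟨f₀.2, SimpleGraph.Reachable.refl _⟩)
    have hPb := E.toRotationSystem.forall_of_connected hG.connected P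
      (fun d hd => by simpa [P, or_comm] using hd)
      (fun d hd => h d _ (E.next_fst d).symm hd) hPa b
    have hgA : g₀.1 ∉ A := fun ⟨_, hr⟩ => hfg hr
    rcases hPb with hPb | hPb
    · exact hgA (hb ▸ hPb)
    · have := hadj b.symm hPb
      rw [SimpleGraph.Dart.symm_symm, hb] at this
      exact hgA (this g₀.2)
  obtain ⟨z, hz, hval⟩ := hG.exists_cycle hfst (fun h => h2 (h ▸ h1))
  obtain ⟨h, rfl⟩ := E.exists_faceBoundary_eq hG.connected E.planar hz
  -- Adding the constant `h E.outer` makes the filling vanish on the outer face, the only face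
  -- outside `A` that can share an edge with `A`.
  have hb := congrFun (E.vertexBoundary_faceBoundary
    (fun f => if f ∈ A then h f + h E.outer else 0)) d₁.fst
  have hval' : ∀ d, E.faceBoundary (fun f => if f ∈ A then h f + h E.outer else 0)
      ⟨d.edge, d.edge_mem⟩ = if P d then E.faceBoundary h ⟨d.edge, d.edge_mem⟩ else 0 := by
    intro d
    rw [RotationSystem.faceBoundary_apply, RotationSystem.faceBoundary_apply]
    have hA' := hadj d.symm
    rw [SimpleGraph.Dart.symm_symm] at hA'
    by_cases hd : E.face d ∈ A
    · rw [if_pos hd, if_pos (Or.inl hd)]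
      by_cases hd' : E.face d.symm ∈ A
      · rw [if_pos hd', add_add_add_comm, CharTwo.add_self_eq_zero, add_zero]
      · have := by_contra fun hh => hd' (hadj d hd hh)
        rw [if_neg hd', this, add_zero]
    · rw [if_neg hd]
      by_cases hd' : E.face d.symm ∈ A
      · have := by_contra fun hh => hd (hA' hd' hh)
        rw [if_pos hd', if_pos (Or.inr hd'), this, zero_add, add_comm]
      · rw [if_neg hd', if_neg (not_or.2 ⟨hd, hd'⟩), zero_add]
  rw [SimpleGraph.vertexBoundary_apply, Pi.zero_apply,
    Finset.sum_eq_single_of_mem d₁ (by simp)] at hb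
  · rw [hval', if_pos h1, hval d₁ rfl, if_pos (Or.inl rfl)] at hb
    exact one_ne_zero hb
  · intro d hd hd1
    rw [hval']
    split_ifs with hPd
    · rw [hval d (by simpa using hd), if_neg]
      rintro (rfl | rfl)
      · exact hd1 rfl
      · exact h2 hPd
    · rfl

/-- A dart both of whose sides are inner faces. -/
structure IsChord (d : G.Dart) : Prop where
  left : E.face d ≠ E.outer
  right : E.face d.symm ≠ E.outer

/-- The combinatorial structure of a polygon dissected by noncrossing diagonals. -/
structure IsDissection : Prop where
  face_ne (d : G.Dart) : E.face d ≠ E.face d.symm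
  outer_unique {d e : G.Dart} : E.face d = E.outer → E.face e = E.outer → d.fst = e.fst → d = e
  chord_unique {d e : G.Dart} : E.IsChord d → E.face d = E.face e →
    E.face d.symm = E.face e.symm → d = e
  isTree : E.weakDual.IsTree

/-- There are at least `|V|` outer darts, and at least as many chord darts as weak dual darts, whose
number is at least `2(|F| - 2)` by connectivity. Euler's formula turns all of these into equalities,
and each equality is one of the claims. -/
theorem isDissection [Finite V] (hV : 3 ≤ Nat.card V) (hG : IsVertexConnected G 2) :
    E.IsDissection := by
  classical
  have := Fintype.ofFinite V
  have := Fintype.ofFinite E.Face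
  have := Fintype.ofFinite E.InnerFace
  have hne := E.planar.face_ne_face_symm hV hG
  have hconn := E.weakDual_connected hV hG
  let O : Finset G.Dart := {d | E.face d = E.outer}
  let C : Finset G.Dart := {d | E.IsChord d}
  have hOV : Fintype.card V ≤ O.card := by
    rw [← Finset.card_univ]
    refine (Finset.card_le_card fun v _ => ?_).trans (Finset.card_image_le (f := fun d => d.fst))
    obtain ⟨d, hd, hv⟩ := E.incident_outer v
    exact Finset.mem_image.2 ⟨d, by simpa [O] using hd, hv⟩
  have hsum : Fintype.card G.Dart = O.card + O.card + C.card := by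
    have hO' : (O.image SimpleGraph.Dart.symm).card = O.card :=
      Finset.card_image_of_injective _ SimpleGraph.Dart.symm_involutive.injective
    have hmem : ∀ d, d ∈ O.image SimpleGraph.Dart.symm ↔ E.face d.symm = E.outer := by
      intro d
      rw [Finset.mem_image]
      constructor
      · rintro ⟨e, he, rfl⟩; simpa [O] using he
      · intro h; exact ⟨d.symm, by simpa [O] using h, by simp⟩
    have hd1 : Disjoint O (O.image SimpleGraph.Dart.symm) := by
      rw [Finset.disjoint_left]
      intro d hd hd'
      rw [hmem] at hd'
      exact hne d (((by simpa [O] using hd : E.face d = E.outer)).trans hd'.symm)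
    have hd2 : Disjoint (O ∪ O.image SimpleGraph.Dart.symm) C := by
      rw [Finset.disjoint_left]
      intro d hd hd'
      have hc : E.IsChord d := by simpa [C] using hd'
      rcases Finset.mem_union.1 hd with hd | hd
      · exact hc.1 (by simpa [O] using hd)
      · exact hc.2 ((hmem d).1 hd)
    rw [← Finset.card_univ, ← hO']
    nth_rewrite 1 [hO']
    rw [← Finset.card_union_of_disjoint hd1, ← Finset.card_union_of_disjoint hd2]
    congr 1
    ext d
    simp only [Finset.mem_univ, Finset.mem_union, hmem, true_iff]
    by_cases h1 : E.face d = E.outer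
    · left; left; simpa [O] using h1
    · by_cases h2 : E.face d.symm = E.outer
      · exact Or.inl (Or.inr h2)
      · right; exact Finset.mem_filter.2 ⟨Finset.mem_univ _, h1, h2⟩
  let D' : Finset (E.Face × E.Face) :=
    Finset.univ.image (fun d : E.weakDual.Dart => (d.fst.1, d.snd.1))
  have hD' : D'.card = Fintype.card E.weakDual.Dart := by
    rw [← Finset.card_univ, Finset.card_image_of_injective]
    rintro ⟨⟨a, b⟩, h⟩ ⟨⟨a', b'⟩, h'⟩ heq
    simp only [Prod.mk.injEq] at heq
    have h1 := Subtype.ext heq.1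
    have h2 := Subtype.ext heq.2
    subst h1 h2
    rfl
  have hsub : D' ⊆ C.image (fun d => (E.face d, E.face d.symm)) := by
    intro x hx
    obtain ⟨⟨⟨a, b⟩, h⟩, -, rfl⟩ := Finset.mem_image.1 hx
    obtain ⟨-, d, hd, hd'⟩ := h
    refine Finset.mem_image.2 ⟨d, ?_, by simp [hd, hd']⟩
    have : E.IsChord d := ⟨hd ▸ a.2, hd' ▸ b.2⟩
    simpa [C] using this
  have hle1 := Finset.card_le_card hsub
  have hle2 := Finset.card_image_le (s := C) (f := fun d => (E.face d, E.face d.symm))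
  have hdG := G.dart_card_eq_twice_card_edges
  have hdT := E.weakDual.dart_card_eq_twice_card_edges
  have hT := hconn.card_vert_le_card_edgeSet_add_one
  have hE := E.planar
  rw [RotationSystem.IsPlanar] at hE
  simp only [Nat.card_eq_fintype_card] at hE hT
  rw [← SimpleGraph.edgeFinset_card] at hE hT
  have hF : Fintype.card E.InnerFace + 1 = Fintype.card E.Face := by
    have h1 : Fintype.card E.InnerFace = Fintype.card {f : E.Face // f ≠ E.outer} :=
      Fintype.card_congr (Equiv.refl _)
    have h2 := Fintype.card_subtype_compl (fun f : E.Face => f = E.outer)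
    have h3 : 0 < Fintype.card E.Face := Fintype.card_pos_iff.2 ⟨E.outer⟩
    rw [Fintype.card_subtype_eq] at h2
    change Fintype.card {f : E.Face // f ≠ E.outer} = _ at h2
    omega
  have hOeq : O.card = Fintype.card V := by omega
  have hCeq : (C.image (fun d => (E.face d, E.face d.symm))).card = C.card := by omega
  refine ⟨hne, ?_, ?_, ?_⟩
  · intro d e hd he hde
    have hinj : Set.InjOn (fun d : G.Dart => d.fst) (O : Set G.Dart) := by
      rw [← Finset.card_image_iff]
      refine le_antisymm Finset.card_image_le ?_
      rw [hOeq, ← Finset.card_univ]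
      refine Finset.card_le_card fun v _ => ?_
      obtain ⟨d, hd, hv⟩ := E.incident_outer v
      exact Finset.mem_image.2 ⟨d, by simpa [O] using hd, hv⟩
    exact hinj (by simpa [O] using hd) (by simpa [O] using he) hde
  · intro d e hd h1 h2
    have he : E.IsChord e := ⟨h1 ▸ hd.1, h2 ▸ hd.2⟩
    exact Finset.card_image_iff.1 hCeq (by simpa [C] using hd) (by simpa [C] using he)
      (Prod.ext h1 h2)
  · rw [SimpleGraph.isTree_iff_connected_and_card]
    refine ⟨hconn, ?_⟩
    rw [Nat.card_eq_fintype_card, Nat.card_eq_fintype_card, ← SimpleGraph.edgeFinset_card]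
    omega

end OuterplanarEmbedding

/-! ### Listing the boundary of a face. -/

theorem Equiv.Perm.SameCycle.exists_lt_pow_eq {α : Type*} [Finite α] {σ : Equiv.Perm α} {x y : α}
    (h : σ.SameCycle x y) {n : ℕ} (hn : (σ ^ (n + 1)) x = x) : ∃ k < n + 1, (σ ^ k) x = y := by
  obtain ⟨m, -, rfl⟩ := h.exists_pow_eq'
  refine ⟨m % (n + 1), Nat.mod_lt _ n.succ_pos, ?_⟩
  rw [Equiv.Perm.coe_pow] at hn
  rw [Equiv.Perm.coe_pow, Equiv.Perm.coe_pow]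
  exact Function.IsPeriodicPt.iterate_mod_apply (f := σ) hn m

/-- Here `N + 1` is the period of `d`, so `e 1, ..., e N` are the other darts of its face. `N` is
positive because a fixed dart would be a loop. -/
theorem RotationSystem.face_cycle {V : Type u} {G : SimpleGraph V} [Finite V]
    (R : RotationSystem G) (d : G.Dart) : ∃ (N : ℕ) (e : ℕ → G.Dart), 0 < N ∧ e 0 = d ∧
      (∀ j, e (j + 1) = R.facePerm (e j)) ∧ e (N + 1) = d ∧ (∀ j, R.face (e j) = R.face d) ∧
      (∀ j < N, e (j + 1) ≠ d) ∧
      (∀ i < N, ∀ j < N, e (i + 1) = e (j + 1) → i = j) ∧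
      ∀ x, R.face x = R.face d → x ≠ d → ∃ j < N, x = e (j + 1) := by
  classical
  have hp : d ∈ Function.periodicPts R.facePerm :=
    Function.mem_periodicPts.2 ((isOfFinOrder_of_finite R.facePerm).elim fun n hn =>
      ⟨n, hn.1, by
        have := hn.2
        rw [isPeriodicPt_mul_iff_pow_eq_one] at *
        rw [Function.IsPeriodicPt, Function.IsFixedPt, ← Equiv.Perm.coe_pow, this]; rfl⟩)
  have h0 := Function.minimalPeriod_pos_of_mem_periodicPts hp
  have h1 : Function.minimalPeriod R.facePerm d ≠ 1 := by
    intro h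
    have := Function.minimalPeriod_eq_one_iff_isFixedPt.1 h
    have h2 := R.facePerm_fst d
    rw [this] at h2
    exact d.fst_ne_snd h2
  obtain ⟨N, hN⟩ : ∃ N, Function.minimalPeriod R.facePerm d = N + 1 := ⟨_, (Nat.sub_add_cancel h0).symm⟩
  have hper : (R.facePerm ^ (N + 1)) d = d := by
    rw [← hN, Equiv.Perm.coe_pow]; exact Function.iterate_minimalPeriod
  have hne : ∀ j < N, (R.facePerm ^ (j + 1)) d ≠ d := by
    intro j hj h
    rw [Equiv.Perm.coe_pow] at h
    have := Function.IsPeriodicPt.minimalPeriod_le (Nat.succ_pos j) h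
    omega
  refine ⟨N, fun j => (R.facePerm ^ j) d, by omega, by simp, fun j => ?_, hper, fun j => ?_, hne,
    fun i hi j hj hij => ?_, ?_⟩
  · simp only [pow_succ', Equiv.Perm.mul_apply]
  · exact R.face_eq_iff.2 (Equiv.Perm.SameCycle.symm ⟨j, by simp⟩)
  · simp only [Equiv.Perm.coe_pow] at hij
    have := (Function.iterate_eq_iterate_iff_of_lt_minimalPeriod
      (by omega : i + 1 < _) (by omega : j + 1 < _)).1 hij
    omega
  · intro x hx hxd
    obtain ⟨k, hk, rfl⟩ := (R.face_eq_iff.1 hx.symm).exists_lt_pow_eq hper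
    cases k with
    | zero => simp at hxd
    | succ k => exact ⟨k, by omega, rfl⟩

/-! ### Propagation of the blue color around vertices and faces. -/

/-- A set of vertices that the color changing rule cannot enlarge. -/
def ForceClosed {V : Type u} (G : SimpleGraph V) (X : Set V) : Prop :=
  ∀ u ∈ X, ∀ v, G.Adj u v → (∀ w, G.Adj u w → w ≠ v → w ∈ X) → v ∈ X

theorem forceClosed_setOf_blue {V : Type u} (G : SimpleGraph V) (B : Set V) :
    ForceClosed G {v | Blue G B v} :=
  fun _ hu _ huv hw => Blue.force hu huv hw

namespace OuterplanarEmbedding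

variable {V : Type u} {G : SimpleGraph V} (E : OuterplanarEmbedding G) (X : Set V)

/-- The tail of `d` is blue, as are its neighbors on the side of `d.symm`. -/
inductive LeftBlue : G.Dart → Prop
  | base {d : G.Dart} (h : E.face d.symm = E.outer) (hd : d.fst ∈ X) : LeftBlue d
  | step {d : G.Dart} (hd : d.fst ∈ X) (he : (E.facePerm d.symm).snd ∈ X)
      (h : LeftBlue (E.facePerm d.symm)) : LeftBlue d

/-- The head of `d` is blue, as are its neighbors on the side of `d.symm`. -/
inductive RightBlue : G.Dart → Prop
  | base {d : G.Dart} (h : E.face d.symm = E.outer) (hd : d.snd ∈ X) : RightBlue d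
  | step {d e : G.Dart} (hde : E.facePerm e = d.symm) (hd : d.snd ∈ X) (he : e.fst ∈ X)
      (h : RightBlue e) : RightBlue d

/-- All vertices of the part of the graph on the side of `d` are blue. -/
inductive Good : G.Dart → Prop
  | outer {d : G.Dart} (h : E.face d = E.outer) (hf : d.fst ∈ X) (hs : d.snd ∈ X) : Good d
  | inner {d : G.Dart} (h : E.face d ≠ E.outer) (hf : d.fst ∈ X) (hs : d.snd ∈ X)
      (hc : ∀ e : G.Dart, E.face e = E.face d → e ≠ d → Good e.symm) : Good d

variable {E X}

theorem LeftBlue.fst_mem {d : G.Dart} (h : E.LeftBlue X d) : d.fst ∈ X := by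
  cases h <;> assumption

theorem RightBlue.snd_mem {d : G.Dart} (h : E.RightBlue X d) : d.snd ∈ X := by
  cases h <;> assumption

theorem Good.fst_mem {d : G.Dart} (h : E.Good X d) : d.fst ∈ X := by
  cases h <;> assumption

theorem Good.snd_mem {d : G.Dart} (h : E.Good X d) : d.snd ∈ X := by
  cases h <;> assumption

theorem Good.child {d e : G.Dart} (h : E.Good X d) (hd : E.face d ≠ E.outer)
    (he : E.face e = E.face d) (hne : e ≠ d) : E.Good X e.symm := by
  cases h with
  | outer h => exact absurd h hd
  | inner _ _ _ hc => exact hc e he hne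

theorem facePerm_ne (d : G.Dart) : E.facePerm d ≠ d := by
  intro h
  have h2 := E.facePerm_fst d
  rw [h] at h2
  exact d.fst_ne_snd h2

theorem Good.leftBlue {d : G.Dart} (h : E.Good X d) : E.LeftBlue X d.symm := by
  induction h with
  | outer h hf hs => exact .base (by simpa using h) hs
  | @inner d h hf hs hc ih =>
    have h1 := ih (E.facePerm d) (E.face_facePerm d) (facePerm_ne d)
    have h2 := hc (E.facePerm d) (E.face_facePerm d) (facePerm_ne d)
    refine .step hs ?_ ?_
    · simpa using h2.fst_mem
    · simpa using h1

theorem Good.rightBlue {d : G.Dart} (h : E.Good X d) : E.RightBlue X d.symm := by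
  induction h with
  | outer h hf hs => exact .base (by simpa using h) hf
  | @inner d h hf hs hc ih =>
    have he : E.facePerm (E.facePerm.symm d) = d := E.facePerm.apply_symm_apply d
    have hF : E.face (E.facePerm.symm d) = E.face d := by
      rw [← E.face_facePerm (E.facePerm.symm d), he]
    have hne : E.facePerm.symm d ≠ d := fun hh => facePerm_ne d (by rw [hh] at he; exact he)
    have h1 := ih _ hF hne
    have h2 := hc _ hF hne
    refine .step (e := E.facePerm.symm d) (by simp) hf ?_ (by simpa using h1)
    exact h2.snd_mem

section

variable [Finite V]

/-- With the outer face on the side of `d`, all edges at its tail other than `d` lie on the other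
side, so the tail has no white neighbor except possibly the head, and forces it. -/
theorem LeftBlue.good (h : E.LeftBlue X d) (D : E.IsDissection) (hX : ForceClosed G X)
    (hd : E.face d = E.outer) : E.Good X d := by
  refine .outer hd h.fst_mem (hX _ h.fst_mem _ d.adj fun w hw hwd => ?_)
  have key : ∃ n, E.face ((E.next ^ (n + 1)) d) = E.outer ∧
      ∀ k < n, ((E.next ^ (k + 1)) d).snd ∈ X := by
    clear hd hwd
    induction h with
    | @base d h hd => exact ⟨0, by simpa [E.face_next] using h, by simp⟩
    | @step d hd he h ih =>
      rw [E.facePerm_symm_apply] at he ih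
      obtain ⟨n, hn, hk⟩ := ih (by rw [E.next_fst]; exact hw)
      refine ⟨n + 1, by rw [pow_succ, Equiv.Perm.mul_apply]; exact hn, fun k hkn => ?_⟩
      cases k with
      | zero => simpa using he
      | succ k =>
        rw [pow_succ, Equiv.Perm.mul_apply]
        exact hk k (by omega)
  obtain ⟨n, hn, hk⟩ := key
  have hfst : ∀ k, ((E.next ^ k) d).fst = d.fst := fun k =>
    ((E.sameCycle_iff _ _).1 ⟨k, by simp⟩).symm
  -- The rotation from `d` meets the outer face again only at `d` itself, so all neighbors have been
  -- seen.
  have hper := D.outer_unique hn hd (hfst _)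
  have hsame : E.next.SameCycle d ⟨(d.fst, w), hw⟩ := (E.sameCycle_iff _ _).2 rfl
  obtain ⟨k, hkn, hke⟩ := hsame.exists_lt_pow_eq hper
  cases k with
  | zero =>
    have : d = ⟨(d.fst, w), hw⟩ := by simpa using hke
    exact absurd (congrArg (fun e : G.Dart => e.snd) this).symm hwd
  | succ k =>
    have := hk k (by omega)
    rwa [hke] at this

theorem RightBlue.good (h : E.RightBlue X d) (D : E.IsDissection) (hX : ForceClosed G X)
    (hd : E.face d = E.outer) : E.Good X d := by
  refine .outer hd (hX _ h.snd_mem _ d.adj.symm fun w hw hwd => ?_) h.snd_mem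
  have key : ∃ n, E.face ((E.next⁻¹ ^ n) d.symm) = E.outer ∧
      ∀ k < n, ((E.next⁻¹ ^ (k + 1)) d.symm).snd ∈ X := by
    clear hd hwd
    induction h with
    | @base d h hd => exact ⟨0, by simpa using h, by simp⟩
    | @step d e hde hd he h ih =>
      have hinv : E.next⁻¹ d.symm = e.symm := by
        rw [Equiv.Perm.inv_eq_iff_eq, ← hde, E.facePerm_apply]
      have hsnd : e.snd = d.snd := by
        rw [← E.facePerm_fst, hde]; rfl
      obtain ⟨n, hn, hk⟩ := ih (by rw [hsnd]; exact hw)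
      refine ⟨n + 1, by rw [pow_succ, Equiv.Perm.mul_apply, hinv]; exact hn, fun k hkn => ?_⟩
      cases k with
      | zero => rw [zero_add, pow_one, hinv]; exact he
      | succ k =>
        rw [pow_succ, Equiv.Perm.mul_apply, hinv]
        exact hk k (by omega)
  obtain ⟨n, hn, hk⟩ := key
  have hfst : ((E.next⁻¹ ^ n) d.symm).fst = d.snd := by
    have : E.next.SameCycle d.symm ((E.next⁻¹ ^ n) d.symm) := ⟨-n, by simp⟩
    exact ((E.sameCycle_iff _ _).1 this).symm
  have hper : (E.next⁻¹ ^ n) d.symm = E.next d.symm := by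
    refine D.outer_unique hn ?_ ?_
    · rw [E.face_next, SimpleGraph.Dart.symm_symm, hd]
    · rw [hfst, E.next_fst]; rfl
  have hper' : (E.next⁻¹ ^ (n + 1)) d.symm = d.symm := by
    rw [pow_succ', Equiv.Perm.mul_apply, hper]
    exact E.next.symm_apply_apply _
  have hsame : E.next⁻¹.SameCycle d.symm ⟨(d.snd, w), hw⟩ :=
    Equiv.Perm.sameCycle_inv.2 ((E.sameCycle_iff _ _).2 rfl)
  obtain ⟨k, hkn, hke⟩ := hsame.exists_lt_pow_eq hper'
  cases k with
  | zero =>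
    have : d.symm = ⟨(d.snd, w), hw⟩ := by simpa using hke
    exact absurd (congrArg (fun e : G.Dart => e.snd) this).symm hwd
  | succ k =>
    have := hk k (by omega)
    rwa [hke] at this

end

/-- The part behind `e (j + 1)` lies between the boundary vertices `j` and `j + 1`. At each inner
vertex exactly one of the two adjacent parts waits for the other, as `p` decides. Runs where `p`
holds are resolved backwards from `hi`, runs where it fails forwards from `lo`. -/
theorem good_of_path {e : ℕ → G.Dart} (he : ∀ j, e (j + 1) = E.facePerm (e j)) (p : ℕ → Prop)
    {lo hi : ℕ}
    (hc : ∀ j, lo ≤ j → j < hi → (p (j + 1) → E.LeftBlue X (e (j + 1)).symm) →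
      (¬ p j → E.RightBlue X (e (j + 1)).symm) → E.Good X (e (j + 1)).symm)
    (hhi : p hi → E.LeftBlue X (e hi).symm) (hlo : ¬ p lo → E.RightBlue X (e (lo + 1)).symm)
    {j : ℕ} (hj : lo ≤ j) (hj' : j < hi) : E.Good X (e (j + 1)).symm := by
  have hleft : ∀ t j, lo < j → j + t = hi → p j → E.LeftBlue X (e j).symm := by
    intro t
    induction t with
    | zero => rintro j - rfl; exact hhi
    | succ t ih =>
      intro j hlj hjt hp
      have hg := hc j hlj.le (by omega) (ih (j + 1) (by omega) (by omega)) (fun h => absurd hp h)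
      have hb := hg.leftBlue
      rw [SimpleGraph.Dart.symm_symm, he] at hb
      refine .step ?_ ?_ (by simpa using hb)
      · have := hg.snd_mem
        rw [he] at this
        change (E.facePerm (e j)).fst ∈ X at this
        rwa [E.facePerm_fst] at this
      · have := hg.fst_mem
        rw [he] at this
        simpa using this
  have hright : ∀ j, lo ≤ j → j < hi → ¬ p j → E.RightBlue X (e (j + 1)).symm := by
    intro j hj
    induction j, hj using Nat.le_induction with
    | base => exact fun _ => hlo
    | succ j hj ih =>
      intro hjh hp
      have hg := hc j hj (by omega) (fun h => absurd h hp) (ih (by omega))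
      have hb := hg.rightBlue
      rw [SimpleGraph.Dart.symm_symm] at hb
      refine .step (e := e (j + 1)) (by rw [he (j + 1), SimpleGraph.Dart.symm_symm]) ?_ hg.snd_mem hb
      have := hg.fst_mem
      change (e (j + 1 + 1)).fst ∈ X
      rw [he (j + 1), E.facePerm_fst]
      exact this
  exact hc j hj hj' (hleft (hi - (j + 1)) (j + 1) (by omega) (by omega)) (hright j hj hj')

/-- The whole boundary is a path from the head to the tail of `d`. If an end part waits there, it
needs the corner on the far side of `d` and also the opposite end of `d`, whence the extra
membership conditions. -/
theorem good_of_children {d : G.Dart} (hd : E.face d ≠ E.outer) {N : ℕ} {e : ℕ → G.Dart}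
    (hN : 0 < N) (h0 : e 0 = d) (he : ∀ j, e (j + 1) = E.facePerm (e j)) (hlast : e (N + 1) = d)
    (hall : ∀ x, E.face x = E.face d → x ≠ d → ∃ j < N, x = e (j + 1)) (p : ℕ → Prop)
    (hc : ∀ j < N, (p (j + 1) → E.LeftBlue X (e (j + 1)).symm) →
      (¬ p j → E.RightBlue X (e (j + 1)).symm) → E.Good X (e (j + 1)).symm)
    (hL : p N → E.LeftBlue X d ∧ d.snd ∈ X) (hR : ¬ p 0 → E.RightBlue X d ∧ d.fst ∈ X) :
    E.Good X d := by
  have hlast' : d.fst = (e N).snd := by rw [← hlast, he, E.facePerm_fst]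
  have hfirst : (e 1).fst = d.snd := by rw [he, h0, E.facePerm_fst]
  have hg : ∀ j < N, E.Good X (e (j + 1)).symm := by
    intro j hj
    refine good_of_path he p (lo := 0) (hi := N) (fun j _ => hc j) ?_ ?_ (Nat.zero_le j) hj
    · intro hp
      obtain ⟨h1, h2⟩ := hL hp
      have hstep : E.facePerm (e N).symm.symm = d := by
        rw [SimpleGraph.Dart.symm_symm, ← he, hlast]
      refine .step (show (e N).snd ∈ X by rw [← hlast']; exact h1.fst_mem) ?_ ?_ <;> rw [hstep] <;> assumption
    · intro hp
      obtain ⟨h1, h2⟩ := hR hp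
      refine .step (e := d) (by rw [SimpleGraph.Dart.symm_symm, he, h0]) ?_ h2 h1
      change (e 1).fst ∈ X
      rw [hfirst]
      exact h1.snd_mem
  refine .inner hd ?_ ?_ ?_
  · obtain ⟨M, rfl⟩ : ∃ M, N = M + 1 := ⟨N - 1, by omega⟩
    rw [hlast']
    exact (hg M (by omega)).fst_mem
  · rw [← hfirst]
    exact (hg 0 hN).snd_mem
  · intro x hx hxd
    obtain ⟨j, hj, rfl⟩ := hall x hx hxd
    exact hg j hj

section

variable [Finite V]

/-- If the blue color enters the side of `d` at its ends, unless the leaf face nearest to that end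
is colored, then it fills that side. -/
def Fills (E : OuterplanarEmbedding G) (X : Set V) (q : V → Prop) (d : G.Dart) : Prop :=
  (q d.fst → E.LeftBlue X d) → (¬ q d.snd → E.RightBlue X d) → E.Good X d

/-- If the ends of `d` differ in `q`, they are either both supplied as blue or neither is needed. If
they agree, one end needs the other to be blue already. A boundary vertex with the other value of
`q` then cuts off a path that fills without using `d` and contains the missing end. -/
theorem fills_of_children {d : G.Dart} (hd : E.face d ≠ E.outer) {q : V → Prop}
    (hc : ∀ x, E.face x = E.face d → x ≠ d → E.Fills X q x.symm)
    (hmix : (q d.fst ↔ q d.snd) → ∃ x, E.face x = E.face d ∧ x ≠ d ∧ ¬ (q x.fst ↔ q x.snd)) :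
    E.Fills X q d := by
  intro hL hR
  obtain ⟨N, e, hN, h0, he, hlast, hface, hne, -, hall⟩ := E.toRotationSystem.face_cycle d
  have hfst : ∀ j, (e (j + 1)).fst = (e j).snd := fun j => by rw [he, E.facePerm_fst]
  have hc' : ∀ j < N, (q (e (j + 1)).snd → E.LeftBlue X (e (j + 1)).symm) →
      (¬ q (e j).snd → E.RightBlue X (e (j + 1)).symm) → E.Good X (e (j + 1)).symm := by
    intro j hj h1 h2
    refine hc _ (hface _) (hne j hj) h1 ?_
    change ¬ q (e (j + 1)).fst → _
    rw [hfst]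
    exact h2
  have hzN : (e N).snd = d.fst := by rw [← hfst, hlast]
  have hz0 : (e 0).snd = d.snd := by rw [h0]
  refine good_of_children hd hN h0 he hlast hall (fun j => q (e j).snd) hc' ?_ ?_
  · intro hp
    rw [hzN] at hp
    refine ⟨hL hp, ?_⟩
    by_cases hw : q d.snd
    · obtain ⟨x, hx, hxd, hxq⟩ := hmix ⟨fun _ => hw, fun _ => hp⟩
      obtain ⟨j, hj, rfl⟩ := hall x hx hxd
      obtain ⟨i, hi, hqi⟩ : ∃ i ≤ N, ¬ q (e i).snd := by
        rw [hfst] at hxq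
        by_cases h : q (e j).snd
        · exact ⟨j + 1, hj, fun h' => hxq ⟨fun _ => h', fun _ => h⟩⟩
        · exact ⟨j, hj.le, h⟩
      have hi0 : 0 < i := Nat.pos_of_ne_zero fun h => hqi (by rw [h, hz0]; exact hw)
      have := good_of_path he (fun j => q (e j).snd) (lo := 0) (hi := i)
        (fun j _ hj => hc' j (by omega)) (fun h => absurd h hqi)
        (fun h => absurd (by rw [hz0]; exact hw) h) le_rfl hi0
      rw [← hz0, ← hfst]
      exact this.snd_mem
    · exact (hR hw).snd_mem
  · intro hp
    rw [hz0] at hp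
    refine ⟨hR hp, ?_⟩
    by_cases hw : q d.fst
    · exact (hL hw).fst_mem
    · obtain ⟨x, hx, hxd, hxq⟩ := hmix ⟨fun h => absurd h hw, fun h => absurd h hp⟩
      obtain ⟨j, hj, rfl⟩ := hall x hx hxd
      obtain ⟨i, hi, hqi⟩ : ∃ i ≤ N, q (e i).snd := by
        rw [hfst] at hxq
        by_cases h : q (e j).snd
        · exact ⟨j, hj.le, h⟩
        · by_contra! h'
          exact hxq ⟨fun h'' => absurd h'' h, fun h'' => absurd h'' (h' (j + 1) hj)⟩
      have hiN : i < N := lt_of_le_of_ne hi fun h => hw (by rw [← hzN, ← h]; exact hqi)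
      obtain ⟨M, rfl⟩ : ∃ M, N = M + 1 := ⟨N - 1, by omega⟩
      have := good_of_path he (fun j => q (e j).snd) (lo := i) (hi := M + 1)
        (fun j _ hj => hc' j hj) (fun h => absurd (by rw [← hzN]; exact h) hw)
        (fun h => absurd hqi h) (show i ≤ M by omega) (by omega)
      rw [← hzN]
      exact this.fst_mem

theorem good_of_leftBlue_of_rightBlue_of_fills {d : G.Dart} (hd : E.face d ≠ E.outer)
    {q : V → Prop} (hc : ∀ x, E.face x = E.face d → x ≠ d → E.Fills X q x.symm)
    (hL : E.LeftBlue X d) (hR : E.RightBlue X d) : E.Good X d := by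
  obtain ⟨N, e, hN, h0, he, hlast, hface, hne, -, hall⟩ := E.toRotationSystem.face_cycle d
  refine good_of_children hd hN h0 he hlast hall (fun j => q (e j).snd) ?_
    (fun _ => ⟨hL, hR.snd_mem⟩) (fun _ => ⟨hR, hL.fst_mem⟩)
  intro j hj h1 h2
  refine hc _ (hface _) (hne j hj) h1 ?_
  change ¬ q (e (j + 1)).fst → _
  rw [show (e (j + 1)).fst = (e j).snd by rw [he, E.facePerm_fst]]
  exact h2

/-- All other edges being outer, the color runs along them from both ends of `d` until it reaches
`x₀` from both sides. -/
theorem good_of_single {d x₀ : G.Dart} (D : E.IsDissection) (hX : ForceClosed G X)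
    (hd : E.face d ≠ E.outer) (hx₀ : E.face x₀ = E.face d) (hne₀ : x₀ ≠ d)
    (hout : ∀ x, E.face x = E.face d → x ≠ d → x ≠ x₀ → E.face x.symm = E.outer)
    (hgood : E.LeftBlue X x₀.symm → E.RightBlue X x₀.symm → E.Good X x₀.symm)
    (hL : E.LeftBlue X d) (hR : E.RightBlue X d) : E.Good X d := by
  obtain ⟨N, e, hN, h0, he, hlast, hface, hne, hinj, hall⟩ := E.toRotationSystem.face_cycle d
  obtain ⟨i, hi, rfl⟩ := hall x₀ hx₀ hne₀
  refine good_of_children hd hN h0 he hlast hall (fun j => i < j) ?_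
    (fun _ => ⟨hL, hR.snd_mem⟩) (fun _ => ⟨hR, hL.fst_mem⟩)
  intro j hj h1 h2
  by_cases hx : e (j + 1) = e (i + 1)
  · obtain rfl := hinj j hj i hi hx
    exact hgood (h1 (by omega)) (h2 (by omega))
  · have ho := hout _ (hface _) (hne j hj) hx
    rcases lt_trichotomy i j with h | rfl | h
    · exact (h1 (by omega)).good D hX ho
    · exact absurd rfl hx
    · exact (h2 (by omega)).good D hX ho

/-- The edge following `d` starts blue, and the color runs from it along the outer edges back to
`d`; nothing is needed from beyond `d`. -/
theorem good_of_adjacent {d : G.Dart} (D : E.IsDissection) (hX : ForceClosed G X)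
    (hd : E.face d ≠ E.outer)
    (hout : ∀ x, E.face x = E.face d → x ≠ d → E.face x.symm = E.outer)
    (ha : d.snd ∈ X) (hb : (E.facePerm d).snd ∈ X) : E.Good X d := by
  obtain ⟨N, e, hN, h0, he, hlast, hface, hne, -, hall⟩ := E.toRotationSystem.face_cycle d
  refine good_of_children hd hN h0 he hlast hall (fun j => j = 0) ?_
    (fun h => absurd h hN.ne') (fun h => absurd rfl h)
  intro j hj h1 h2
  have ho := hout _ (hface _) (hne j hj)
  cases j with
  | zero =>
    have h10 : e (0 + 1) = E.facePerm d := by rw [he, h0]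
    refine .outer ho ?_ ?_
    · rw [h10]; exact hb
    · rw [h10]
      change (E.facePerm d).fst ∈ X
      rw [E.facePerm_fst]
      exact ha
  | succ j => exact (h2 (Nat.succ_ne_zero j)).good D hX ho

end

end OuterplanarEmbedding

/-! ### Chords and degrees in the weak dual. -/

namespace OuterplanarEmbedding

variable {V : Type u} {G : SimpleGraph V} {E : OuterplanarEmbedding G} {X : Set V}

theorem IsChord.symm {d : G.Dart} (h : E.IsChord d) : E.IsChord d.symm :=
  ⟨h.2, by simpa using h.1⟩

/-- The inner face on the side of `d`. -/
def side (E : OuterplanarEmbedding G) (d : G.Dart) (h : E.face d ≠ E.outer) : E.InnerFace :=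
  ⟨E.face d, h⟩

theorem side_eq {d : G.Dart} {h : E.face d ≠ E.outer} {f : E.InnerFace} (hd : E.face d = f.1) :
    E.side d h = f :=
  Subtype.ext hd

theorem IsDissection.adj_of_isChord (D : E.IsDissection) {d : G.Dart} (h : E.IsChord d) :
    E.weakDual.Adj (E.side d h.1) (E.side d.symm h.2) :=
  ⟨fun heq => D.face_ne d (congrArg Subtype.val heq), d, rfl, rfl⟩

theorem exists_isChord_of_adj {f g : E.InnerFace} (h : E.weakDual.Adj f g) :
    ∃ d, E.IsChord d ∧ E.face d = f.1 ∧ E.face d.symm = g.1 := by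
  obtain ⟨-, d, hf, hg⟩ := h
  exact ⟨d, ⟨hf ▸ f.2, hg ▸ g.2⟩, hf, hg⟩

/-- The chords on the boundary of a face, directed along it. -/
def chordsAt (E : OuterplanarEmbedding G) (f : E.Face) : Set G.Dart :=
  {d | E.face d = f ∧ E.IsChord d}

theorem IsDissection.deg_eq_ncard (D : E.IsDissection) (f : E.InnerFace) :
    deg E.weakDual f = (E.chordsAt f.1).ncard := by
  symm
  refine Set.ncard_congr (fun d hd => (E.side d.symm hd.2.2)) ?_ ?_ ?_
  · rintro d ⟨hd, hc⟩
    have := D.adj_of_isChord hc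
    rwa [side_eq hd] at this
  · rintro d e ⟨hd, hc⟩ ⟨he, _⟩ heq
    exact D.chord_unique hc (hd.trans he.symm) (congrArg Subtype.val heq)
  · intro g hg
    obtain ⟨d, hc, hd, hd'⟩ := exists_isChord_of_adj hg
    exact ⟨d, ⟨hd, hc⟩, Subtype.ext hd'⟩

theorem IsDissection.exists_ne_of_two_le_deg (D : E.IsDissection) {f : E.InnerFace}
    (hf : 2 ≤ deg E.weakDual f) (d : G.Dart) : ∃ e, E.face e = f.1 ∧ E.IsChord e ∧ e ≠ d := by
  rw [D.deg_eq_ncard] at hf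
  obtain ⟨e, he, hne⟩ := Set.exists_ne_of_one_lt_ncard (s := E.chordsAt f.1) (by omega) d
  exact ⟨e, he.1, he.2, hne⟩

section Finite

variable [Finite V]

theorem IsDissection.eq_of_isLeafVertex (D : E.IsDissection) {f : E.InnerFace}
    (hf : IsLeafVertex E.weakDual f) {d e : G.Dart} (hd : E.face d = f.1) (hdc : E.IsChord d)
    (he : E.face e = f.1) (hec : E.IsChord e) : d = e := by
  rw [IsLeafVertex, D.deg_eq_ncard] at hf
  exact (Set.ncard_le_one (Set.toFinite _)).1 hf d ⟨hd, hdc⟩ e ⟨he, hec⟩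

theorem IsDissection.eq_of_deg_eq_two (D : E.IsDissection) {f : E.InnerFace}
    (hf : deg E.weakDual f = 2) {d e x : G.Dart} (hd : E.face d = f.1) (hdc : E.IsChord d)
    (he : E.face e = f.1) (hec : E.IsChord e) (hde : d ≠ e)
    (hx : E.face x = f.1) (hxc : E.IsChord x) : x = d ∨ x = e := by
  rw [D.deg_eq_ncard] at hf
  have hsub : ({d, e} : Set G.Dart) ⊆ E.chordsAt f.1 := by
    rintro y (rfl | rfl)
    exacts [⟨hd, hdc⟩, ⟨he, hec⟩]
  have := Set.eq_of_subset_of_ncard_le hsub (by rw [hf, Set.ncard_pair hde]) (Set.toFinite _)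
  have hx' : x ∈ E.chordsAt f.1 := ⟨hx, hxc⟩
  rw [← this] at hx'
  exact hx'

end Finite

/-! ### Pendant paths of the weak dual -/

/-- The side of `d` in the weak dual is a path that ends in a leaf. -/
inductive PathOut (E : OuterplanarEmbedding G) : G.Dart → Prop
  | leaf {d : G.Dart} (hd : E.face d ≠ E.outer) (hf : IsLeafVertex E.weakDual (E.side d hd)) :
      PathOut E d
  | step {d e : G.Dart} (hd : E.IsChord d) (hf : deg E.weakDual (E.side d hd.1) = 2)
      (he : E.face e = E.face d) (hne : e ≠ d) (hec : E.IsChord e) (h : PathOut E e.symm) :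
      PathOut E d

theorem exists_pathOut_of_adj_leaf {f g : E.InnerFace} (hfg : E.weakDual.Adj f g)
    (hg : IsLeafVertex E.weakDual g) : ∃ e, E.face e = f.1 ∧ E.IsChord e ∧ E.PathOut e.symm := by
  obtain ⟨d, hc, hd, hd'⟩ := exists_isChord_of_adj hfg
  refine ⟨d, hd, hc, .leaf hc.2 ?_⟩
  rwa [side_eq hd']

theorem exists_pathOut_of_adj {f g : E.InnerFace} (hf : 2 ≤ deg E.weakDual f)
    (hfg : E.weakDual.Adj f g) (hg : deg E.weakDual g = 2)
    (hex : ∃ e, E.face e = g.1 ∧ E.IsChord e ∧ E.PathOut e.symm) :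
    ∃ e, E.face e = f.1 ∧ E.IsChord e ∧ E.PathOut e.symm := by
  obtain ⟨d, hc, hd, hd'⟩ := exists_isChord_of_adj hfg
  obtain ⟨e, he, hec, hp⟩ := hex
  -- In this case the pendant path found at `g` runs back through `f`; as `f` is not its final leaf,
  -- the path continues out of `f`.
  by_cases hed : e = d.symm
  · rw [hed, SimpleGraph.Dart.symm_symm] at hp
    have hfd : E.side d hc.1 = f := Subtype.ext hd
    cases hp with
    | leaf _ hl =>
      rw [hfd, IsLeafVertex] at hl
      omega
    | @step _ e' _ _ he' _ hec' h => exact ⟨e', he'.trans hd, hec', h⟩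
  · refine ⟨d, hd, hc, .step hc.symm ?_ (he.trans hd'.symm) hed hec hp⟩
    rwa [side_eq hd']

theorem _root_.IsBranchVertex.deg_eq_two {W : Type u} {T : SimpleGraph W} {x : W}
    (h : IsBranchVertex T x) : deg T x = 2 := by
  cases h <;> assumption

theorem exists_pathOut_of_isBranchVertex {f : E.InnerFace} (h : IsBranchVertex E.weakDual f) :
    ∃ e, E.face e = f.1 ∧ E.IsChord e ∧ E.PathOut e.symm := by
  induction h with
  | of_leaf _ hxy hy => exact exists_pathOut_of_adj_leaf hxy hy
  | of_branch hx hxy hy ih => exact exists_pathOut_of_adj hx.ge hxy hy.deg_eq_two ih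

theorem NoTrunkCycles.exists_pathOut (hE : E.NoTrunkCycles) {f : E.InnerFace}
    (hf : ¬ IsLeafVertex E.weakDual f) :
    ∃ e, E.face e = f.1 ∧ E.IsChord e ∧ E.PathOut e.symm := by
  have hf2 : 2 ≤ deg E.weakDual f := by rw [IsLeafVertex] at hf; omega
  have := hE f
  rw [IsTrunkVertex, not_and] at this
  obtain ⟨g, hg⟩ := not_forall.1 (this hf2)
  obtain ⟨hfg, hg⟩ := Classical.not_imp.1 hg
  by_cases hl : IsLeafVertex E.weakDual g
  · exact exists_pathOut_of_adj_leaf hfg hl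
  · have hb : IsBranchVertex E.weakDual g := by tauto
    exact exists_pathOut_of_adj hf2 hfg hb.deg_eq_two (exists_pathOut_of_isBranchVertex hb)

/-! ### The weak dual as a rooted tree -/

open Classical in
/-- The distance of an inner face from the root `L` in the weak dual. -/
noncomputable def height (E : OuterplanarEmbedding G) (L : E.InnerFace) (f : E.Face) : ℕ :=
  if h : f ≠ E.outer then E.weakDual.dist L ⟨f, h⟩ else 0

theorem height_val (L f : E.InnerFace) : E.height L f.1 = E.weakDual.dist L f := dif_pos f.2

theorem dist_side {L : E.InnerFace} {d : G.Dart} (h : E.face d ≠ E.outer) :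
    E.weakDual.dist L (E.side d h) = E.height L (E.face d) :=
  (height_val L (E.side d h)).symm

/-- Crossing the edge of `d` to the side of `d` leads away from the root `L`. -/
def Down (E : OuterplanarEmbedding G) (L : E.InnerFace) (d : G.Dart) : Prop :=
  E.face d.symm ≠ E.outer ∧
    (E.face d = E.outer ∨ E.height L (E.face d.symm) < E.height L (E.face d))

variable {L : E.InnerFace}

theorem IsDissection.height_of_isChord (D : E.IsDissection) {d : G.Dart} (hd : E.IsChord d) :
    E.height L (E.face d) = E.height L (E.face d.symm) + 1 ∨
      E.height L (E.face d.symm) = E.height L (E.face d) + 1 := by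
  have h := D.isTree.dist_eq_dist_add_one_of_adj L (D.adj_of_isChord hd)
  rwa [← height_val, ← height_val] at h

theorem Down.not_symm {d : G.Dart} (hd : E.Down L d) : ¬ E.Down L d.symm := by
  intro h
  rcases hd.2 with h1 | h1
  · exact h.1 (by simpa using h1)
  · rcases h.2 with h2 | h2
    · exact hd.1 h2
    · rw [SimpleGraph.Dart.symm_symm] at h2
      omega

theorem Down.isChord {d : G.Dart} (hd : E.Down L d) (h : E.face d ≠ E.outer) : E.IsChord d :=
  ⟨h, hd.1⟩

theorem Down.height_lt {d : G.Dart} (hd : E.Down L d) (h : E.face d ≠ E.outer) :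
    E.height L (E.face d.symm) < E.height L (E.face d) :=
  hd.2.resolve_left h

theorem Down.face_ne_root {d : G.Dart} (hd : E.Down L d) : E.face d ≠ L.1 := by
  intro h
  have h1 := hd.height_lt (h ▸ L.2)
  rw [h, height_val, SimpleGraph.dist_self] at h1
  omega

/-- Two ways towards the root would give two paths to it in a tree. -/
theorem IsDissection.down_unique (D : E.IsDissection) {d e : G.Dart} (hd : E.Down L d)
    (he : E.Down L e) (hde : E.face d = E.face e) (hin : E.face d ≠ E.outer) : d = e := by
  have hdc := hd.isChord hin
  have hec := he.isChord (hde ▸ hin)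
  have key : ∀ x, E.Down L x → (hx : E.IsChord x) →
      ∃ p : E.weakDual.Walk (E.side x hx.1) L, p.IsPath ∧ p.snd = (E.side x.symm hx.2) := by
    intro x hxd hx
    obtain ⟨p, hp, hpl⟩ := (D.isTree.connected (E.side x.symm hx.2) L).exists_path_of_dist
    refine ⟨.cons (D.adj_of_isChord hx) p, ?_, by simp⟩
    refine SimpleGraph.Walk.isPath_of_length_eq_dist _ ?_
    have h1 := D.height_of_isChord (L := L) hx
    have h2 := hxd.height_lt hx.1
    rw [SimpleGraph.Walk.length_cons, hpl, SimpleGraph.dist_comm, SimpleGraph.dist_comm (v := L),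
      dist_side, dist_side]
    omega
  obtain ⟨p, hp, hp'⟩ := key d hd hdc
  obtain ⟨q, hq, hq'⟩ := key e he hec
  refine D.chord_unique hdc hde ?_
  have hfe : E.side d hdc.1 = (E.side e hec.1) := Subtype.ext hde
  have := (D.isTree.existsUnique_path (E.side d hdc.1) L).unique hp
    (y₂ := q.copy hfe.symm rfl) (by simpa using hq)
  rw [this] at hp'
  have h3 : (q.copy hfe.symm rfl).snd = q.snd := by
    rw [SimpleGraph.Walk.snd, SimpleGraph.Walk.snd, SimpleGraph.Walk.getVert_copy]
  rw [h3, hq'] at hp'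
  exact (congrArg Subtype.val hp').symm

theorem IsDissection.exists_down (D : E.IsDissection) {f : E.InnerFace} (hf : f ≠ L) :
    ∃ d, E.face d = f.1 ∧ E.Down L d := by
  obtain ⟨p, hp, hpl⟩ := (D.isTree.connected f L).exists_path_of_dist
  cases p with
  | nil => exact absurd rfl hf
  | @cons _ g _ h p =>
    obtain ⟨d, hc, hd, hd'⟩ := exists_isChord_of_adj h
    refine ⟨d, hd, hc.2, Or.inr ?_⟩
    rw [hd, hd', height_val, height_val, SimpleGraph.dist_comm, SimpleGraph.dist_comm (v := f),
      ← hpl, SimpleGraph.Walk.length_cons]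
    have := SimpleGraph.dist_le p
    omega

theorem IsDissection.down_child (D : E.IsDissection) {d e : G.Dart} (hd : E.Down L d)
    (hin : E.face d ≠ E.outer) (he : E.face e = E.face d) (hne : e ≠ d) : E.Down L e.symm := by
  refine ⟨by rw [SimpleGraph.Dart.symm_symm, he]; exact hin, ?_⟩
  rw [or_iff_not_imp_left]
  intro h
  have hc : E.IsChord e := ⟨he ▸ hin, h⟩
  rw [SimpleGraph.Dart.symm_symm]
  rcases D.height_of_isChord (L := L) hc with h1 | h1
  · exact absurd (D.down_unique (L := L) ⟨h, Or.inr (by omega)⟩ hd he (he ▸ hin)) hne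
  · omega

theorem height_le [Finite V] (f : E.Face) : E.height L f ≤ Nat.card E.InnerFace := by
  classical
  have := Fintype.ofFinite E.InnerFace
  rw [height]
  split_ifs with h
  · by_cases hr : E.weakDual.Reachable L ⟨f, h⟩
    · obtain ⟨p, hp, hpl⟩ := hr.exists_path_of_dist
      rw [← hpl, Nat.card_eq_fintype_card]
      exact hp.length_lt.le
    · rw [SimpleGraph.dist_eq_zero_of_not_reachable hr]
      omega
  · omega

theorem down_induction [Finite V] {P : G.Dart → Prop}
    (h : ∀ d, E.Down L d → (E.face d ≠ E.outer → ∀ e, E.Down L e → E.face e.symm = E.face d → P e) →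
      P d) {d : G.Dart} (hd : E.Down L d) : P d := by
  have key : ∀ n d, E.Down L d → E.face d ≠ E.outer →
      Nat.card E.InnerFace - E.height L (E.face d) = n → P d := by
    intro n
    induction n using Nat.strong_induction_on with
    | _ n ih =>
      intro d hd hin hn
      refine h d hd fun _ e he hed => ?_
      by_cases ho : E.face e = E.outer
      · exact h e he fun h' => absurd ho h'
      · have h1 := he.height_lt ho
        have h2 := height_le (L := L) (E.face e)
        rw [hed] at h1
        exact ih _ (by omega) e he ho rfl
  by_cases ho : E.face d = E.outer
  · exact h d hd fun h' => absurd ho h'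
  · exact key _ d hd ho rfl

/-! ### Forcing -/

/-- A labeling of the vertices along the outer face that changes its parity at the leaf faces,
together with the set of leaf faces where it changes from odd to even. -/
structure IsLabeling (E : OuterplanarEmbedding G) (L : E.InnerFace) (κ : V → ℕ)
    (S : Set E.InnerFace) : Prop where
  eq_of_not_leaf {d : G.Dart} (hd : E.face d = E.outer) (h : E.face d.symm ≠ E.outer)
    (hl : ¬ IsLeafVertex E.weakDual (E.side d.symm h)) : κ d.fst = κ d.snd
  succ_of_leaf {d : G.Dart} (hd : E.Down L d) (h : E.face d ≠ E.outer)
    (hl : IsLeafVertex E.weakDual (E.side d h)) : κ d.snd = κ d.fst + 1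
  mem_iff {d : G.Dart} (hd : E.Down L d) (h : E.face d ≠ E.outer)
    (hl : IsLeafVertex E.weakDual (E.side d h)) :
    E.side d h ∈ S ↔ Odd (κ d.fst)

variable [Finite V] {κ : V → ℕ} {S : Set E.InnerFace}

/-- Beyond `d` lies a path with a single leaf. Each degree-two face passes the jump on, since its
edges other than the two chords leave `κ` unchanged. -/
theorem IsLabeling.succ_of_pathOut (hκ : E.IsLabeling L κ S) (D : E.IsDissection) {d : G.Dart}
    (hp : E.PathOut d) (hd : E.Down L d) : κ d.snd = κ d.fst + 1 := by
  induction hp with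
  | leaf h hl => exact hκ.succ_of_leaf hd h hl
  | @step d x hdc hf hx hne hxc hp ih =>
    have ih := ih (D.down_child hd hdc.1 hx hne)
    obtain ⟨N, e, hN, h0, he, hlast, hface, hne', hinj, hall⟩ := E.toRotationSystem.face_cycle d
    have hfst : ∀ j, (e (j + 1)).fst = (e j).snd := fun j => by rw [he, E.facePerm_fst]
    obtain ⟨i, hi, rfl⟩ := hall x hx hne
    have hstep : ∀ j < N, j ≠ i → κ (e (j + 1)).snd = κ (e j).snd := by
      intro j hj hji
      have ho : E.face (e (j + 1)).symm = E.outer := by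
        by_contra ho
        have hc : E.IsChord (e (j + 1)) := ⟨by rw [hface]; exact hdc.1, ho⟩
        rcases D.eq_of_deg_eq_two hf rfl hdc hx hxc hne.symm (hface _) hc with h | h
        · exact hne' j hj h
        · exact hji (hinj j hj i hi h)
      have hin : E.face (e (j + 1)).symm.symm ≠ E.outer := by
        rw [SimpleGraph.Dart.symm_symm, hface]; exact hdc.1
      have := hκ.eq_of_not_leaf ho hin (by
        have : (E.side ((e (j + 1)).symm.symm) hin) = (E.side d hdc.1) :=
          side_eq ((congrArg E.face (SimpleGraph.Dart.symm_symm _)).trans (hface _))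
        rw [this, IsLeafVertex, hf]
        omega)
      rw [← hfst j]
      exact this
    have hi' : κ (e i).snd = κ (e (i + 1)).snd + 1 := by rw [← hfst]; exact ih
    have h1 : ∀ j, j ≤ i → κ (e j).snd = κ d.snd := by
      intro j
      induction j with
      | zero => intro _; rw [h0]
      | succ j ihj => intro hj; rw [hstep j (by omega) (by omega), ihj (by omega)]
    have h2 : ∀ j, i + 1 ≤ j → j ≤ N → κ (e j).snd = κ (e (i + 1)).snd := by
      intro j hj
      induction j, hj using Nat.le_induction with
      | base => exact fun _ => rfl
      | succ j hj ihj => intro hjN; rw [hstep j (by omega) (by omega), ihj (by omega)]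
    rw [← h1 i le_rfl, hi', ← h2 N hi le_rfl, ← hfst, hlast]

theorem IsDissection.good_of_leaf (D : E.IsDissection) (hX : ForceClosed G X) {d : G.Dart}
    (hdc : E.IsChord d) (hl : IsLeafVertex E.weakDual (E.side d hdc.1)) (hL : E.LeftBlue X d)
    (hR : E.RightBlue X d) : E.Good X d := by
  have hout : ∀ x, E.face x = E.face d → x ≠ d → E.face x.symm = E.outer := by
    intro x hx hne
    by_contra h
    exact hne (D.eq_of_isLeafVertex hl hx ⟨hx ▸ hdc.1, h⟩ rfl hdc)
  exact good_of_single D hX hdc.1 (E.face_facePerm d) (facePerm_ne d)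
    (fun x hx hne _ => hout x hx hne)
    (fun h _ => h.good D hX (hout _ (E.face_facePerm d) (facePerm_ne d))) hL hR

/-- Induction from the leaves of the tree towards the root. An outer edge has equal labels, so one
end is supplied; a leaf outside `S` goes from even to odd, so both are. Any other face has a pendant
path, not beyond `d` by `hp`, whose base has ends of different parity. -/
theorem IsLabeling.fills (hκ : E.IsLabeling L κ S) (D : E.IsDissection) (hX : ForceClosed G X)
    (hE : E.NoTrunkCycles)
    (hS : ∀ d (h : E.IsChord d), IsLeafVertex E.weakDual (E.side d h.1) → E.side d h.1 ∈ S →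
      E.Good X d) {d : G.Dart} (hd : E.Down L d) (hp : ¬ E.PathOut d.symm) :
    E.Fills X (fun v => Even (κ v)) d := by
  revert hp
  refine down_induction (P := fun d => ¬ E.PathOut d.symm → E.Fills X (fun v => Even (κ v)) d)
    (L := L) ?_ hd
  intro d hd ih hp
  by_cases ho : E.face d = E.outer
  · have heq := hκ.eq_of_not_leaf ho hd.1 fun hl => hp (.leaf hd.1 hl)
    intro h1 h2
    by_cases hq : Even (κ d.fst)
    · exact (h1 hq).good D hX ho
    · exact (h2 (show ¬ Even (κ d.snd) by rwa [← heq])).good D hX ho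
  · have hdc := hd.isChord ho
    by_cases hl : IsLeafVertex E.weakDual (E.side d ho)
    · by_cases hmem : E.side d ho ∈ S
      · exact fun _ _ => hS d hdc hl hmem
      · intro h1 h2
        change ¬ Even (κ d.snd) → _ at h2
        rw [hκ.mem_iff hd ho hl, Nat.not_odd_iff_even] at hmem
        refine D.good_of_leaf hX hdc hl (h1 hmem) (h2 ?_)
        rw [hκ.succ_of_leaf hd ho hl, Nat.not_even_iff_odd]
        exact hmem.add_one
    · refine fills_of_children ho (fun x hx hne => ?_) fun _ => ?_
      · refine ih ho x.symm (D.down_child hd ho hx hne)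
          ((congrArg E.face (SimpleGraph.Dart.symm_symm _)).trans hx) ?_
        rw [SimpleGraph.Dart.symm_symm]
        intro hpx
        cases hpx with
        | leaf h hl' => exact hl (by rwa [show (E.side x h) = (E.side d ho)
            from Subtype.ext hx] at hl')
        | @step _ y hxc hf hy hyx hyc h =>
          rcases D.eq_of_deg_eq_two hf rfl hxc hy hyc hyx.symm hx.symm hdc with h' | h'
          · exact hne h'.symm
          · exact hp (h' ▸ h)
      · obtain ⟨x, hx, hxc, hpx⟩ := hE.exists_pathOut hl
        have hne : x ≠ d := fun h => hp (h ▸ hpx)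
        refine ⟨x, hx, hne, ?_⟩
        have : κ x.fst = κ x.snd + 1 := hκ.succ_of_pathOut D hpx (D.down_child hd ho hx hne)
        rw [this, Nat.even_add_one]
        tauto

/-- This covers the case that the far side of `d` is a pendant path. Both corners are handed on
through faces of degree two. At a face of larger degree no child has a pendant path behind it, so
`IsLabeling.fills` applies to all children. -/
theorem IsLabeling.good_of_leftBlue_of_rightBlue (hκ : E.IsLabeling L κ S) (D : E.IsDissection)
    (hX : ForceClosed G X) (hE : E.NoTrunkCycles)
    (hS : ∀ d (h : E.IsChord d), IsLeafVertex E.weakDual (E.side d h.1) → E.side d h.1 ∈ S →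
      E.Good X d) {d : G.Dart} (hd : E.Down L d) (hL : E.LeftBlue X d) (hR : E.RightBlue X d) :
    E.Good X d := by
  revert hL hR
  refine down_induction (P := fun d => E.LeftBlue X d → E.RightBlue X d → E.Good X d)
    (L := L) ?_ hd
  intro d hd ih hL hR
  by_cases ho : E.face d = E.outer
  · exact hL.good D hX ho
  have hdc := hd.isChord ho
  by_cases hl : IsLeafVertex E.weakDual (E.side d ho)
  · exact D.good_of_leaf hX hdc hl hL hR
  have h2 : 2 ≤ deg E.weakDual (E.side d ho) := by rw [IsLeafVertex] at hl; omega
  by_cases hf : deg E.weakDual (E.side d ho) = 2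
  · obtain ⟨x, hx, hxc, hne⟩ := D.exists_ne_of_two_le_deg h2 d
    refine good_of_single D hX ho hx hne (fun y hy hyd hyx => ?_)
      (ih ho x.symm (D.down_child hd ho hx hne)
          ((congrArg E.face (SimpleGraph.Dart.symm_symm _)).trans hx)) hL hR
    by_contra h
    rcases D.eq_of_deg_eq_two hf rfl hdc hx hxc hne.symm hy ⟨hy ▸ ho, h⟩ with h' | h'
    · exact hyd h'
    · exact hyx h'
  · refine good_of_leftBlue_of_rightBlue_of_fills (q := fun v => Even (κ v)) ho (fun x hx hne => ?_) hL hR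
    refine hκ.fills D hX hE hS (D.down_child hd ho hx hne) ?_
    rw [SimpleGraph.Dart.symm_symm]
    have hfx : ∀ h, E.side x h = (E.side d ho) := fun h => Subtype.ext hx
    intro hpx
    cases hpx with
    | leaf h hl' => exact hl (by rwa [hfx] at hl')
    | step hxc hf' => exact hf (by rwa [hfx] at hf')

/-- The color leaves `L` through its only chord with both corners blue, which fills everything
beyond. Each face inherits a good dart from its parent, by induction on the height, and every vertex
lies on an inner face. -/
theorem IsLabeling.forall_mem (hκ : E.IsLabeling L κ S) (D : E.IsDissection)
    (hX : ForceClosed G X) (hE : E.NoTrunkCycles)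
    (hS : ∀ d (h : E.IsChord d), IsLeafVertex E.weakDual (E.side d h.1) → E.side d h.1 ∈ S →
      E.Good X d) {r : G.Dart} (hr : E.face r = L.1) (hrg : E.Good X r)
    (hr' : ∀ x, E.face x = L.1 → E.IsChord x → x = r) (v : V) : v ∈ X := by
  have key : ∀ n (f : E.InnerFace), E.height L f.1 = n →
      ∃ p, E.face p = f.1 ∧ E.Good X p ∧ (f ≠ L → E.Down L p) := by
    intro n
    induction n using Nat.strong_induction_on with
    | _ n ih =>
      intro f hn
      by_cases hf : f = L
      · subst hf; exact ⟨r, hr, hrg, fun h => absurd rfl h⟩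
      · obtain ⟨d, hd, hdown⟩ := D.exists_down hf
        have hin : E.face d ≠ E.outer := hd ▸ f.2
        have hlt := hdown.height_lt hin
        refine ⟨d, hd, ?_, fun _ => hdown⟩
        by_cases hg : E.face d.symm = L.1
        · have hdr := hr' d.symm hg (hdown.isChord hin).symm
          rw [← hdr] at hrg
          have h1 := hrg.leftBlue
          have h2 := hrg.rightBlue
          rw [SimpleGraph.Dart.symm_symm] at h1 h2
          exact hκ.good_of_leftBlue_of_rightBlue D hX hE hS hdown h1 h2
        · obtain ⟨p, hp, hpg, hpd⟩ := ih _ (by rw [← hn, ← hd]; exact hlt)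
            (E.side d.symm hdown.1) rfl
          have hpd := hpd fun h => hg (congrArg Subtype.val h)
          have := hpg.child (hp ▸ hdown.1) hp.symm (e := d.symm)
            (fun h => hdown.not_symm (h ▸ hpd))
          simpa using this
  obtain ⟨o, ho, rfl⟩ := E.incident_outer v
  have hin : E.face o.symm ≠ E.outer := fun h => D.face_ne o (ho.trans h.symm)
  obtain ⟨p, hp, hpg, -⟩ := key _ (E.side o.symm hin) rfl
  by_cases hop : o.symm = p
  · rw [← hop] at hpg
    exact hpg.snd_mem
  · have := hpg.child (hp ▸ hin) hp.symm hop
    simpa using this.fst_mem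

end OuterplanarEmbedding

/-! ### The outer walk and the labeling it defines. -/

namespace OuterplanarEmbedding

variable {V : Type u} {G : SimpleGraph V} {E : OuterplanarEmbedding G} {L : E.InnerFace}

theorem IsDissection.exists_reference (D : E.IsDissection) [Finite V] (f : E.InnerFace) :
    ∃ r, E.face r = f.1 ∧ (IsLeafVertex E.weakDual f →
      ∀ x, E.face x = f.1 → x ≠ r → E.face x.symm = E.outer) := by
  by_cases h : ∃ r, E.face r = f.1 ∧ E.IsChord r
  · obtain ⟨r, hr, hrc⟩ := h
    refine ⟨r, hr, fun hf x hx hne => ?_⟩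
    by_contra ho
    exact hne (D.eq_of_isLeafVertex hf hx ⟨hx ▸ f.2, ho⟩ hr hrc)
  · obtain ⟨r, hr⟩ := E.face_surjective f.1
    refine ⟨r, hr, fun _ x hx _ => ?_⟩
    by_contra ho
    exact h ⟨x, hx, hx ▸ f.2, ho⟩

theorem IsDissection.exists_isLeafVertex [Finite V] (D : E.IsDissection) :
    ∃ L, IsLeafVertex E.weakDual L := by
  classical
  have := Fintype.ofFinite E.InnerFace
  rcases subsingleton_or_nontrivial E.InnerFace with h | h
  · obtain ⟨L⟩ := D.isTree.connected.nonempty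
    refine ⟨L, ?_⟩
    rw [IsLeafVertex, deg, Set.eq_empty_of_forall_notMem (s := E.weakDual.neighborSet L)
      fun x hx => E.weakDual.ne_of_adj hx (Subsingleton.elim _ _)]
    simp
  · obtain ⟨L, hL⟩ := D.isTree.exists_vert_degree_one_of_nontrivial
    refine ⟨L, ?_⟩
    rw [IsLeafVertex, deg, Set.ncard_eq_toFinset_card']
    exact hL.le

/-- An enumeration of the outer darts along the outer face that ends on the face `L`. -/
structure IsOuterWalk (E : OuterplanarEmbedding G) (L : E.InnerFace) (N : ℕ) (o : ℕ → G.Dart)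
    (idx : V → ℕ) : Prop where
  succ (j : ℕ) : o (j + 1) = E.facePerm (o j)
  outer (j : ℕ) : E.face (o j) = E.outer
  exists_eq {x : G.Dart} (hx : E.face x = E.outer) : ∃ j ≤ N, x = o j
  last : E.face (o N).symm = L.1
  idx_le (v : V) : idx v ≤ N
  idx_fst {j : ℕ} (hj : j ≤ N) : idx (o j).fst = j

theorem IsDissection.exists_isOuterWalk [Finite V] (D : E.IsDissection)
    (hL : IsLeafVertex E.weakDual L) : ∃ N o idx, E.IsOuterWalk L N o idx := by
  obtain ⟨r, hr, hr'⟩ := D.exists_reference L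
  -- The edge after `r` on `L` is outer. The walk is cut right behind it, so that its last edge lies
  -- on `L`.
  have hx := hr' hL (E.facePerm r) ((E.face_facePerm r).trans hr) (facePerm_ne r)
  obtain ⟨N, e, hN, h0, he, hlast, hface, hne, hinj, hall⟩ :=
    E.toRotationSystem.face_cycle (E.facePerm r).symm
  have hex : ∀ x, E.face x = E.outer → ∃ j ≤ N, x = e (j + 1) := by
    intro x hx'
    by_cases hxd : x = (E.facePerm r).symm
    · exact ⟨N, le_rfl, hxd.trans hlast.symm⟩
    · obtain ⟨j, hj, rfl⟩ := hall x (hx'.trans hx.symm) hxd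
      exact ⟨j, hj.le, rfl⟩
  have hinj' : ∀ i ≤ N, ∀ j ≤ N, e (i + 1) = e (j + 1) → i = j := by
    intro i hi j hj hij
    rcases hi.lt_or_eq with hi | rfl
    · rcases hj.lt_or_eq with hj | rfl
      · exact hinj i hi j hj hij
      · exact absurd (hij.trans hlast) (hne i hi)
    · rcases hj.lt_or_eq with hj | rfl
      · exact absurd (hij.symm.trans hlast) (hne j hj)
      · rfl
  have hidx : ∀ v, ∃ j ≤ N, (e (j + 1)).fst = v := by
    intro v
    obtain ⟨x, hx', rfl⟩ := E.incident_outer v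
    obtain ⟨j, hj, rfl⟩ := hex x hx'
    exact ⟨j, hj, rfl⟩
  choose idx hle hfst using hidx
  refine ⟨N, fun j => e (j + 1), idx, fun j => he _, fun j => (hface _).trans hx, fun {x} => hex x, ?_,
    hle, fun {j} hj => ?_⟩
  · rw [hlast, SimpleGraph.Dart.symm_symm, E.face_facePerm, hr]
  · exact hinj' _ (hle _) _ hj
      (D.outer_unique ((hface _).trans hx) ((hface _).trans hx) (hfst _))

/-- The leaf faces other than `L` that border one of the first `i` outer darts. -/
def metLeaves (E : OuterplanarEmbedding G) (L : E.InnerFace) (o : ℕ → G.Dart) (i : ℕ) :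
    Set E.InnerFace :=
  {f | IsLeafVertex E.weakDual f ∧ f ≠ L ∧ ∃ j < i, E.face (o j).symm = f.1}

theorem metLeaves_mono {o : ℕ → G.Dart} {i j : ℕ} (h : i ≤ j) :
    E.metLeaves L o i ⊆ E.metLeaves L o j :=
  fun _ ⟨h1, h2, k, hk, h3⟩ => ⟨h1, h2, k, by omega, h3⟩

namespace IsOuterWalk

variable {N : ℕ} {o : ℕ → G.Dart} {idx : V → ℕ}

theorem lt_of_face_ne (hw : E.IsOuterWalk L N o idx) {i : ℕ} (hi : i ≤ N)
    (h : E.face (o i).symm ≠ L.1) : i < N :=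
  lt_of_le_of_ne hi fun h' => h (h' ▸ hw.last)

/-- The last dart is excluded because the walk closes up there and the index returns to zero. -/
theorem idx_snd (hw : E.IsOuterWalk L N o idx) {i : ℕ} (hi : i < N) : idx (o i).snd = i + 1 := by
  rw [← E.facePerm_fst, ← hw.succ, hw.idx_fst hi]

theorem metLeaves_succ_of_not_leaf (hw : E.IsOuterWalk L N o idx)
    (hL : IsLeafVertex E.weakDual L) {d : G.Dart} (hd : E.face d = E.outer)
    (h : E.face d.symm ≠ E.outer) (hl : ¬ IsLeafVertex E.weakDual (E.side d.symm h)) :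
    E.metLeaves L o (idx d.fst) = E.metLeaves L o (idx d.snd) := by
  obtain ⟨i, hi, rfl⟩ := hw.exists_eq hd
  have hiN := hw.lt_of_face_ne hi fun h' => hl (by rwa [side_eq h'])
  rw [hw.idx_fst hi, hw.idx_snd hiN]
  refine (metLeaves_mono (Nat.le_succ i)).antisymm ?_
  rintro f ⟨h1, h2, j, hj, hj'⟩
  refine ⟨h1, h2, j, ?_, hj'⟩
  rcases Nat.lt_succ_iff_lt_or_eq.1 hj with hj | rfl
  · exact hj
  · exact absurd h1 (by rwa [side_eq hj'] at hl)

variable [Finite V]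

/-- All edges of a leaf but its chord are outer, so going around the leaf traverses the outer walk
backwards, one index per step. No step wraps around, as the last outer edge belongs to `L`. -/
theorem leaf_interval (hw : E.IsOuterWalk L N o idx) (D : E.IsDissection) {d : G.Dart}
    (hd : E.Down L d) (h : E.face d ≠ E.outer) (hl : IsLeafVertex E.weakDual (E.side d h)) :
    idx d.fst < idx d.snd ∧
      ∀ i ≤ N, E.face (o i).symm = E.face d ↔ idx d.fst ≤ i ∧ i < idx d.snd := by
  have hdc := hd.isChord h
  have hout : ∀ x, E.face x = E.face d → x ≠ d → E.face x.symm = E.outer := by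
    intro x hx hne
    by_contra ho
    exact hne (D.eq_of_isLeafVertex hl hx ⟨hx ▸ h, ho⟩ rfl hdc)
  obtain ⟨M, e, hM, h0, he, hlast, hface, hne, -, hall⟩ := E.toRotationSystem.face_cycle d
  have hfst : ∀ j, (e (j + 1)).fst = (e j).snd := fun j => by rw [he, E.facePerm_fst]
  have hstep : ∀ j < M, ∃ k < N, (e (j + 1)).symm = o k ∧ idx (e (j + 1)).snd = k ∧
      idx (e j).snd = k + 1 := by
    intro j hj
    obtain ⟨k, hk, hko⟩ := hw.exists_eq (hout _ (hface (j + 1)) (hne j hj))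
    have hkN : k < N := hw.lt_of_face_ne hk (by
      rw [← hko, SimpleGraph.Dart.symm_symm, hface]; exact hd.face_ne_root)
    refine ⟨k, hkN, hko, ?_, ?_⟩
    · rw [← hw.idx_fst hk, ← hko]; rfl
    · rw [← hw.idx_snd hkN, ← hko, ← hfst]; rfl
  have hidx : ∀ j, j ≤ M → idx (e j).snd + j = idx d.snd := by
    intro j
    induction j with
    | zero => intro _; rw [h0]; rfl
    | succ j ih =>
      intro hj
      obtain ⟨k, -, -, h1, h2⟩ := hstep j (by omega)
      have := ih (by omega)
      omega
  have hM' := hidx M le_rfl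
  rw [← hfst, hlast] at hM'
  refine ⟨by omega, fun i hi => ⟨fun hf => ?_, fun ⟨h1, h2⟩ => ?_⟩⟩
  · obtain ⟨j, hj, hji⟩ := hall _ hf fun h' => by
      have := hdc.2
      rw [← h', SimpleGraph.Dart.symm_symm] at this
      exact this (hw.outer i)
    have hi' := hw.idx_fst hi
    have : (o i).fst = (e (j + 1)).snd := by rw [← hji]; rfl
    rw [this] at hi'
    have := hidx (j + 1) hj
    omega
  · obtain ⟨k, -, hko, hk, -⟩ := hstep (idx d.snd - 1 - i) (by omega)
    have := hidx (idx d.snd - 1 - i + 1) (by omega)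
    have hki : k = i := by omega
    rw [← hki, ← hko, SimpleGraph.Dart.symm_symm, hface]

theorem ncard_metLeaves_of_leaf (hw : E.IsOuterWalk L N o idx) (D : E.IsDissection) {d : G.Dart}
    (hd : E.Down L d) (h : E.face d ≠ E.outer) (hl : IsLeafVertex E.weakDual (E.side d h)) :
    E.side d h ∉ E.metLeaves L o (idx d.fst) ∧
    (E.metLeaves L o (idx d.snd)).ncard = (E.metLeaves L o (idx d.fst)).ncard + 1 := by
  obtain ⟨hlt, hint⟩ := hw.leaf_interval D hd h hl
  have hN := hw.idx_le d.snd
  have hnot : E.side d h ∉ E.metLeaves L o (idx d.fst) := by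
    rintro ⟨-, -, j, hj, hj'⟩
    have := (hint j (by omega)).1 hj'
    omega
  refine ⟨hnot, ?_⟩
  rw [← Set.ncard_insert_of_notMem hnot (Set.toFinite _)]
  congr 1
  ext f
  constructor
  · rintro ⟨h1, h2, j, hj, hj'⟩
    by_cases hja : j < idx d.fst
    · exact Or.inr ⟨h1, h2, j, hja, hj'⟩
    · left
      have := (hint j (by omega)).2 ⟨by omega, hj⟩
      exact (side_eq (this.symm.trans hj')).symm
  · rintro (rfl | hf)
    · refine ⟨hl, fun h' => hd.face_ne_root (congrArg Subtype.val h'), idx d.fst, hlt, ?_⟩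
      exact (hint _ (by omega)).2 ⟨le_rfl, hlt⟩
    · exact metLeaves_mono hlt.le hf

/-- The intervals of two leaf faces along the outer face are disjoint. -/
theorem le_or_le_of_leaf (hw : E.IsOuterWalk L N o idx) (D : E.IsDissection) {d e : G.Dart}
    (hd : E.Down L d) (h : E.face d ≠ E.outer) (hl : IsLeafVertex E.weakDual (E.side d h))
    (he : E.Down L e) (h' : E.face e ≠ E.outer) (hl' : IsLeafVertex E.weakDual (E.side e h'))
    (hne : E.face d ≠ E.face e) : idx d.snd ≤ idx e.fst ∨ idx e.snd ≤ idx d.fst := by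
  by_contra! hcon
  obtain ⟨hlt, hint⟩ := hw.leaf_interval D hd h hl
  obtain ⟨hlt', hint'⟩ := hw.leaf_interval D he h' hl'
  have hN := hw.idx_le d.snd
  have h1 := (hint (max (idx d.fst) (idx e.fst)) (by omega)).2 (by omega)
  have h2 := (hint' (max (idx d.fst) (idx e.fst)) (by omega)).2 (by omega)
  exact hne (h1.symm.trans h2)

end IsOuterWalk

theorem _root_.Nat.card_filter_odd_range (m : ℕ) :
    ((Finset.range m).filter Odd).card = m / 2 := by
  induction m with
  | zero => rfl
  | succ m ih =>
    rw [Finset.range_add_one, Finset.filter_insert]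
    split_ifs with h
    · rw [Finset.card_insert_of_notMem (by simp), ih]
      obtain ⟨k, rfl⟩ := h
      omega
    · rw [ih]
      obtain ⟨k, rfl⟩ := Nat.not_odd_iff_even.1 h
      omega

theorem _root_.Nat.ceil_div_two (n : ℕ) : ⌈((n + 1 : ℕ) : ℚ) / 2⌉₊ = n / 2 + 1 := by
  rw [Nat.ceil_eq_iff (by omega)]
  have h1 : n / 2 * 2 ≤ n := Nat.div_mul_le_self n 2
  have h2 : n + 1 ≤ (n / 2 + 1) * 2 := by omega
  have h1' : ((n / 2 : ℕ) : ℚ) * 2 ≤ n := by exact_mod_cast h1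
  have h2' : ((n + 1 : ℕ) : ℚ) ≤ ((n / 2 + 1 : ℕ) : ℚ) * 2 := by exact_mod_cast h2
  constructor
  · rw [Nat.add_sub_cancel, lt_div_iff₀ (by norm_num)]
    push_cast
    linarith
  · rw [div_le_iff₀ (by norm_num)]
    exact h2'

theorem IsDissection.exists_isLabeling [Finite V] (D : E.IsDissection)
    (hL : IsLeafVertex E.weakDual L) :
    ∃ κ S, E.IsLabeling L κ S ∧ L ∈ S ∧ E.IsEveryOtherLeaf S := by
  classical
  obtain ⟨N, o, idx, hw⟩ := D.exists_isOuterWalk hL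
  let κ : V → ℕ := fun v => (E.metLeaves L o (idx v)).ncard
  -- `par f` is the edge from `f` to its parent; at `L` its value is arbitrary.
  have hpar : ∀ f : E.InnerFace, ∃ d, f ≠ L → E.face d = f.1 ∧ E.Down L d := by
    intro f
    by_cases hf : f = L
    · obtain ⟨d, -⟩ := E.face_surjective f.1
      exact ⟨d, fun h => absurd hf h⟩
    · obtain ⟨d, hd⟩ := D.exists_down hf
      exact ⟨d, fun _ => hd⟩
  choose par hpar using hpar
  -- The root comes just before the leaf labeled zero, so adding it to the odd labels gives an
  -- alternating choice.
  let S : Set E.InnerFace := insert L {f | f ∈ E.leafFaces \ {L} ∧ Odd (κ (par f).fst)}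
  have hface : ∀ {f : E.InnerFace}, f ≠ L → E.face (par f) ≠ E.outer :=
    fun {f} hf => (hpar f hf).1 ▸ f.2
  have hleaf : ∀ {f : E.InnerFace} (hf : f ≠ L), f ∈ E.leafFaces →
      IsLeafVertex E.weakDual (E.side (par f) (hface hf)) := by
    intro f hf h
    rwa [side_eq (hpar f hf).1]
  have hsucc : ∀ {d : G.Dart} (hd : E.Down L d) (h : E.face d ≠ E.outer)
      (hl : IsLeafVertex E.weakDual (E.side d h)), κ d.snd = κ d.fst + 1 :=
    fun hd h hl => (hw.ncard_metLeaves_of_leaf D hd h hl).2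
  have hmono : ∀ {v w : V}, idx v ≤ idx w → κ v ≤ κ w :=
    fun h => Set.ncard_le_ncard (metLeaves_mono h) (Set.toFinite _)
  refine ⟨κ, S, ⟨fun hd h hl => ?_, fun hd h hl => hsucc hd h hl, fun {d} hd h hl => ?_⟩,
    Or.inl rfl, ?_, ?_, ?_⟩
  · exact congrArg Set.ncard (hw.metLeaves_succ_of_not_leaf hL hd h hl)
  · have hne : E.side d h ≠ L := fun h' => hd.face_ne_root (congrArg Subtype.val h')
    obtain ⟨h1, h2⟩ := hpar _ hne
    have hpd : par (E.side d h) = d := D.down_unique h2 hd h1 (hface hne)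
    constructor
    · rintro (h' | ⟨-, h'⟩)
      · exact absurd h' hne
      · rwa [hpd] at h'
    · intro h'
      exact Or.inr ⟨⟨hl, hne⟩, by rwa [hpd]⟩
  · rintro f (rfl | hf)
    · exact hL
    · exact hf.1.1
  · let A : Finset E.InnerFace := (Set.toFinite (E.leafFaces \ {L})).toFinset
    have hA : ∀ f, f ∈ A ↔ f ∈ E.leafFaces ∧ f ≠ L := fun f => by simp [A]
    have hAcard : E.numLeaves = A.card + 1 := by
      rw [numLeaves, ← Set.ncard_sdiff_singleton_add_one (show L ∈ E.leafFaces from hL)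
        (Set.toFinite _), Set.ncard_eq_toFinset_card _ (Set.toFinite _)]
    have hinj : Set.InjOn (fun f => κ (par f).fst) (A : Set E.InnerFace) := by
      intro f hf g hg hfg
      obtain ⟨hf1, hf2⟩ := (hA f).1 hf
      obtain ⟨hg1, hg2⟩ := (hA g).1 hg
      by_contra hne
      have h1 := hsucc (hpar f hf2).2 (hface hf2) (hleaf hf2 hf1)
      have h2 := hsucc (hpar g hg2).2 (hface hg2) (hleaf hg2 hg1)
      have hfg' : κ (par f).fst = κ (par g).fst := hfg
      rcases hw.le_or_le_of_leaf D (hpar f hf2).2 (hface hf2) (hleaf hf2 hf1) (hpar g hg2).2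
        (hface hg2) (hleaf hg2 hg1) (by
          rw [(hpar f hf2).1, (hpar g hg2).1]; exact fun h => hne (Subtype.ext h)) with h | h
      · have := hmono h; omega
      · have := hmono h; omega
    have himage : A.image (fun f => κ (par f).fst) = Finset.range A.card := by
      refine Finset.eq_of_subset_of_card_le ?_ ?_
      · intro i hi
        obtain ⟨f, hf, rfl⟩ := Finset.mem_image.1 hi
        obtain ⟨hf1, hf2⟩ := (hA f).1 hf
        rw [Finset.mem_range, ← Set.ncard_coe_finset]
        refine Set.ncard_lt_ncard ?_ (Set.toFinite _)
        refine ⟨fun g hg => (hA g).2 ⟨hg.1, hg.2.1⟩, fun h => ?_⟩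
        have h1 := (hw.ncard_metLeaves_of_leaf D (hpar f hf2).2 (hface hf2) (hleaf hf2 hf1)).1
        rw [side_eq (hpar f hf2).1] at h1
        exact h1 (h hf)
      · rw [Finset.card_range, Finset.card_image_of_injOn hinj]
    have hodd : {f | f ∈ E.leafFaces \ {L} ∧ Odd (κ (par f).fst)} =
        (A.filter (fun f => Odd (κ (par f).fst)) : Finset E.InnerFace) := by
      ext f
      simp [A]
    -- With `n` leaves, those other than `L` carry the labels `0, ..., n - 2`, of which `⌊(n - 1) /
    -- 2⌋` are odd; together with `L` this makes `⌈n / 2⌉`.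
    rw [Set.ncard_insert_of_notMem (fun h => h.1.2 rfl) (Set.toFinite _), hodd,
      Set.ncard_coe_finset, hAcard, Nat.ceil_div_two, ← Nat.card_filter_odd_range, ← himage,
      Finset.filter_image, Finset.card_image_of_injOn]
    exact hinj.mono (Finset.coe_subset.2 (Finset.filter_subset _ _))
  · rintro f g hfg ⟨hf, hg, d, k, hd, hk, hdf, hdg, hmid⟩
    by_cases hfL : f = L
    · exact Or.inl (Or.inl hfL)
    by_cases hgL : g = L
    · exact Or.inr (Or.inl hgL)
    obtain ⟨i, hi, rfl⟩ := hw.exists_eq hd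
    have hpow : ∀ j, (E.facePerm ^ j) (o i) = o (i + j) := by
      intro j
      induction j with
      | zero => simp
      | succ j ih => rw [pow_succ', Equiv.Perm.mul_apply, ih, ← add_assoc, hw.succ]
    simp only [hpow] at hdg hmid
    have hiN := hw.lt_of_face_ne hi (by rw [hdf]; exact fun h => hfL (Subtype.ext h))
    -- Otherwise the stretch from `f` to `g` would contain the last outer edge, which lies on the
    -- leaf `L`.
    have hik : i + k ≤ N := by
      by_contra! h
      refine hmid (N - i) (by omega) (by omega) L hL ?_
      rw [show i + (N - i) = N by omega, hw.last]
    obtain ⟨hf1, hf2⟩ := hpar f hfL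
    obtain ⟨hg1, hg2⟩ := hpar g hgL
    have h1 := (hw.leaf_interval D hf2 (hface hfL) (hleaf hfL hf)).2 i hi |>.1 (hdf.trans hf1.symm)
    have h2 := (hw.leaf_interval D hg2 (hface hgL) (hleaf hgL hg)).2 (i + k) hik
      |>.1 (hdg.trans hg1.symm)
    have hle : idx (par f).snd ≤ idx (par g).fst := by
      rcases hw.le_or_le_of_leaf D hf2 (hface hfL) (hleaf hfL hf) hg2 (hface hgL) (hleaf hgL hg)
        (by rw [hf1, hg1]; exact fun h => hfg (Subtype.ext h)) with h | h <;> omega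
    have heq : κ (par g).fst = κ (par f).snd := by
      refine congrArg Set.ncard (Set.Subset.antisymm ?_ (metLeaves_mono hle))
      rintro h ⟨hl, hne, j, hj, hjh⟩
      refine ⟨hl, hne, j, ?_, hjh⟩
      by_contra! hcon
      refine hmid (j - i) (by omega) (by omega) h hl ?_
      rw [show i + (j - i) = j by omega, hjh]
    rw [hsucc hf2 (hface hfL) (hleaf hfL hf)] at heq
    by_cases hodd : Odd (κ (par f).fst)
    · exact Or.inl (Or.inr ⟨⟨hf, hfL⟩, hodd⟩)
    · refine Or.inr (Or.inr ⟨⟨hg, hgL⟩, ?_⟩)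
      rw [heq]
      exact (Nat.not_odd_iff_even.1 hodd).add_one

end OuterplanarEmbedding

/-! ### Assembling the zero forcing set. -/

theorem mainTheorem6 {V : Type u} [Finite V] (G : SimpleGraph V) (hV : 3 ≤ Nat.card V)
    (hG : IsVertexConnected G 2) (E : OuterplanarEmbedding G) (hE : E.NoTrunkCycles) :
    zeroForcingNumber G ≤ 2 * ⌈(E.numLeaves : ℚ) / 2⌉₊ ∧
    ∃ (S : Set E.InnerFace) (a b : E.InnerFace → V), E.IsEveryOtherLeaf S ∧
      (∀ f ∈ S, G.Adj (a f) (b f) ∧ E.Incident (a f) f.1 ∧ E.Incident (b f) f.1) ∧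
      IsZeroForcingSet G {v : V | ∃ f ∈ S, v = a f ∨ v = b f} := by
  have D := E.isDissection hV hG
  obtain ⟨L, hL⟩ := D.exists_isLeafVertex
  obtain ⟨κ, S, hκ, hLS, hS⟩ := D.exists_isLabeling hL
  choose r hr hout using D.exists_reference
  -- The colored pair consists of the ends of the boundary edge following `r f`; for a leaf that has
  -- a chord, `r f` is this chord.
  let a : E.InnerFace → V := fun f => (r f).snd
  let b : E.InnerFace → V := fun f => (E.facePerm (r f)).snd
  let B : Set V := {v : V | ∃ f ∈ S, v = a f ∨ v = b f}
  have hX := forceClosed_setOf_blue G B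
  have hgood : ∀ f ∈ S, E.Good {v | Blue G B v} (r f) := by
    intro f hf
    refine OuterplanarEmbedding.good_of_adjacent D hX (hr f ▸ f.2)
      (fun x hx hne => hout f (hS.1 hf) x (hx.trans (hr f)) hne) ?_ ?_
    · exact Blue.init (show a f ∈ B from ⟨f, hf, Or.inl rfl⟩)
    · exact Blue.init (show b f ∈ B from ⟨f, hf, Or.inr rfl⟩)
  have hzf : IsZeroForcingSet G B := by
    refine hκ.forall_mem D hX hE (fun d hd hl hmem => ?_) (hr L) (hgood L hLS) fun x hx hxc => ?_
    · have hd' : d = r (E.side d hd.1) := by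
        by_contra hne
        exact hd.2 (hout _ hl d rfl hne)
      rw [hd']
      exact hgood _ hmem
    · by_contra hne
      exact hxc.2 (hout L hL x hx hne)
  refine ⟨?_, S, a, b, hS, fun f hf => ⟨?_, ?_, ?_⟩, hzf⟩
  · rw [← hS.2.1]
    have h0 : zeroForcingNumber G ≤ B.ncard := Nat.sInf_le ⟨B, hzf, rfl⟩
    refine h0.trans ?_
    have hB : B ⊆ a '' S ∪ b '' S := by
      rintro v ⟨f, hf, rfl | rfl⟩
      exacts [Or.inl ⟨f, hf, rfl⟩, Or.inr ⟨f, hf, rfl⟩]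
    have h1 := Set.ncard_le_ncard hB (Set.toFinite _)
    have h2 := Set.ncard_union_le (a '' S) (b '' S)
    have h3 := Set.ncard_image_le (f := a) (Set.toFinite S)
    have h4 := Set.ncard_image_le (f := b) (Set.toFinite S)
    omega
  · have := (E.facePerm (r f)).adj
    rwa [E.facePerm_fst] at this
  · exact ⟨E.facePerm (r f), (E.face_facePerm _).trans (hr f), E.facePerm_fst _⟩
  · exact ⟨E.facePerm (E.facePerm (r f)),
      (E.face_facePerm _).trans ((E.face_facePerm _).trans (hr f)), E.facePerm_fst _⟩
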